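/- Let $\mathbb{K}$ be a field of arbitrary characteristic. A (curved) complete shifted $A_\infty$-algebra $(A,Q)$ is a $\mathbb{Z}$-graded $\mathbb{K}$-vector space $A$ with multilinear operations $Q_n\colon A^{\otimes n}\to A$ of degree $+1$ for all $n\ge 0$ (the operation $Q_0$ is allowed to be nonzero) satisfying, with the Koszul sign rule, $$\sum_{a+b+c=n}Q_{a+c+1}\circ(\mathrm{id}^{\otimes a}\otimes Q_b\otimes \mathrm{id}^{\otimes c})=0\qquad (n\ge 0),$$ (equivalently, a codifferential on the tensor coalgebra of $A$), together with a decreasing filtration $A=F^1A\supseteq F^2A\supseteq\cdots$ by graded subspaces such that $\bigcap_k F^kA=0$, $A$ is complete (as a graded vector space, i.e. degree by degree) for the filtration topology, and $Q_n(F^{i_1}A\otimes\cdots\otimes F^{i_n}A)\subseteq F^{i_1+\cdots+i_n}A$. A strict morphism $f\colon (A,Q)\to(B,P)$ is a degree $0$ linear map with $f(F^kA)\subseteq F^kB$ for all $k$ and $P_n\circ f^{\otimes n}=f\circ Q_n$ for all $n\ge 0$. For $n\ge 0$ let $N^\bullet(\Delta^n)$ be the normalized cochains of the standard $n$-simplex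 with coefficients in $\mathbb{K}$, with coboundary $d$, cup product $\cup$ and unit $\mathbb{1}$. Equip $A\otimes N^\bullet(\Delta^n)$ with the filtration $F^kA\otimes N^\bullet(\Delta^n)$ and the operations $$NQ_0(1)=Q_0(1)\otimes \mathbb{1},\qquad NQ_1=Q_1\otimes \mathrm{id}+\mathrm{id}\otimes d,\qquad NQ_l=Q_l\otimes\cup^{(l)}\quad (l\ge 2),$$ where Koszul signs are used and $\cup^{(l)}$ is the iterated cup product of $l$ factors. The Maurer-Cartan simplicial set $MC_\bullet(A,Q)$ has as $n$-simplices the Maurer-Cartan elements of $A\otimes N^\bullet(\Delta^n)$, i.e. the elements $x$ of degree $0$ such that $\sum_{l\ge 0}NQ_l(x,\dots,x)=0$ (a convergent series in the filtration topology), and its face and degeneracy maps are induced by the pullback of cochains. If $f\colon(A,Q)\to(B,P)$ is a surjective strict morphism of complete shifted $A_\infty$-algebras, then the induced map of simplicial sets $MC_\bullet(A,Q)\to MC_\bullet(B,P)$, $x\mapsto (f\otimes\mathrm{id})(x)$, is a Kan fibration. -/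

import Mathlib

open CategoryTheory TensorProduct
open scoped SSet.modelCategoryQuillen

universe u v

noncomputable section

namespace AInfinity

/-! ### Normalized cochains on a simplex -/

/-- Nondegenerate simplices of the simplex with ordered vertex set `V`: nonempty subsets of `V`. -/
abbrev Face (V : Type) : Type := {I : Finset V // I.Nonempty}

/-- The dimension of a face, as an integer. -/
def Face.dim {V : Type} (I : Face V) : ℤ := (I.1.card : ℤ) - 1

/-- The (total space of the) normalized cochains `N^•(Δ)` of the simplex `Δ` with ordered vertex
set `V`: functions on the nondegenerate simplices of `Δ`. For `Δ = Δⁿ` one takes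
`V = {0 < 1 < … < n}`. -/
def Cochain (K : Type u) (V : Type) : Type u := Face V → K

namespace Cochain

@[ext] theorem ext {K : Type u} {V : Type} {φ ψ : Cochain K V} (h : ∀ I, φ I = ψ I) : φ = ψ :=
  funext h

variable {K : Type u} [Field K] {V W U : Type}

instance : AddCommGroup (Cochain K V) := inferInstanceAs (AddCommGroup (Face V → K))
instance : Module K (Cochain K V) := inferInstanceAs (Module K (Face V → K))

/-- The value of a cochain on the face with vertex set `s` (zero if `s` is empty). -/
def evalOn (φ : Cochain K V) (s : Finset V) : K :=
  open Classical in if h : s.Nonempty then φ ⟨s, h⟩ else 0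

/-- The basis cochain `φ_I`, equal to `1` on the face `I` and to `0` on all other faces. -/
def basisCochain (I : Face V) : Cochain K V := open Classical in Pi.single I 1

@[simp] theorem add_apply (φ ψ : Cochain K V) (I : Face V) : (φ + ψ) I = φ I + ψ I := rfl
@[simp] theorem smul_apply (c : K) (φ : Cochain K V) (I : Face V) : (c • φ) I = c * φ I := rfl
@[simp] theorem zero_apply (I : Face V) : (0 : Cochain K V) I = 0 := rfl

@[simp] theorem evalOn_empty (φ : Cochain K V) : φ.evalOn ∅ = 0 := by simp [evalOn]

@[simp] theorem evalOn_face (φ : Cochain K V) (I : Face V) : φ.evalOn I.1 = φ I := by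
  simp [evalOn, I.2]

@[simp] theorem evalOn_add (φ ψ : Cochain K V) (s : Finset V) :
    (φ + ψ).evalOn s = φ.evalOn s + ψ.evalOn s := by
  by_cases h : s.Nonempty <;> simp [evalOn, h]

@[simp] theorem evalOn_smul (c : K) (φ : Cochain K V) (s : Finset V) :
    (c • φ).evalOn s = c * φ.evalOn s := by
  by_cases h : s.Nonempty <;> simp [evalOn, h]

@[simp] theorem evalOn_zero (s : Finset V) : (0 : Cochain K V).evalOn s = 0 := by
  by_cases h : s.Nonempty <;> simp [evalOn, h]

variable (K V) in
/-- The cochains of degree `q`: those supported on the faces of dimension `q`. -/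
def degreePart (q : ℤ) : Submodule K (Cochain K V) where
  carrier := {φ | ∀ I : Face V, I.dim ≠ q → φ I = 0}
  add_mem' := fun ha hb I hI => by simp [ha I hI, hb I hI]
  zero_mem' := fun _ _ => rfl
  smul_mem' := fun c φ h I hI => by simp [h I hI]

/-- The unit cochain `𝟙 = ∑ᵢ φ_i`, with value `1` on every vertex. -/
instance : One (Cochain K V) := ⟨fun I => if I.1.card = 1 then 1 else 0⟩

theorem one_apply (I : Face V) : (1 : Cochain K V) I = if I.1.card = 1 then 1 else 0 := rfl

theorem evalOn_one (s : Finset V) : (1 : Cochain K V).evalOn s = if s.card = 1 then 1 else 0 := by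
  by_cases h : s.Nonempty
  · simp [evalOn, h, one_apply]
  · simp only [Finset.not_nonempty_iff_eq_empty] at h
    simp [h]

section Order

variable [LinearOrder V] [LinearOrder W] [LinearOrder U]

/-- The cup product: on a face `x` with vertices `x_0 < … < x_m`,
`(φ ∪ ψ)(x) = ∑_{i} φ(x_0, …, x_i) ψ(x_i, …, x_m)`. If `φ` has degree `i` and `ψ` has degree `m - i`
only one term of the sum can be nonzero. -/
instance : Mul (Cochain K V) :=
  ⟨fun φ ψ I => ∑ v ∈ I.1, φ.evalOn (I.1.filter (· ≤ v)) * ψ.evalOn (I.1.filter (v ≤ ·))⟩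

theorem mul_apply (φ ψ : Cochain K V) (I : Face V) :
    (φ * ψ) I = ∑ v ∈ I.1, φ.evalOn (I.1.filter (· ≤ v)) * ψ.evalOn (I.1.filter (v ≤ ·)) := rfl

theorem evalOn_mul (φ ψ : Cochain K V) (s : Finset V) :
    (φ * ψ).evalOn s = ∑ v ∈ s, φ.evalOn (s.filter (· ≤ v)) * ψ.evalOn (s.filter (v ≤ ·)) := by
  by_cases h : s.Nonempty
  · simp [evalOn, h, mul_apply]
  · simp only [Finset.not_nonempty_iff_eq_empty] at h
    simp [h]

theorem one_mul' (φ : Cochain K V) : 1 * φ = φ := by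
  ext I
  rw [mul_apply, Finset.sum_eq_single_of_mem (I.1.min' I.2) (I.1.min'_mem I.2)]
  · have h1 : I.1.filter (· ≤ I.1.min' I.2) = {I.1.min' I.2} := by
      ext w
      simp only [Finset.mem_filter, Finset.mem_singleton]
      constructor
      · rintro ⟨hw, h⟩
        exact le_antisymm h (I.1.min'_le w hw)
      · rintro rfl
        exact ⟨I.1.min'_mem I.2, le_rfl⟩
    have h2 : I.1.filter (I.1.min' I.2 ≤ ·) = I.1 :=
      Finset.filter_true_of_mem fun w hw => I.1.min'_le w hw
    rw [h1, h2]
    simp [evalOn_one]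
  · intro v hv hne
    rw [evalOn_one, if_neg, zero_mul]
    intro hc
    obtain ⟨a, ha⟩ := Finset.card_eq_one.1 hc
    have h1 : v ∈ I.1.filter (· ≤ v) := by simp [hv]
    have h2 : I.1.min' I.2 ∈ I.1.filter (· ≤ v) := by
      simp [I.1.min'_mem I.2, I.1.min'_le v hv]
    rw [ha, Finset.mem_singleton] at h1 h2
    exact hne (h1.trans h2.symm)

theorem mul_one' (φ : Cochain K V) : φ * 1 = φ := by
  ext I
  rw [mul_apply, Finset.sum_eq_single_of_mem (I.1.max' I.2) (I.1.max'_mem I.2)]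
  · have h1 : I.1.filter (I.1.max' I.2 ≤ ·) = {I.1.max' I.2} := by
      ext w
      simp only [Finset.mem_filter, Finset.mem_singleton]
      constructor
      · rintro ⟨hw, h⟩
        exact le_antisymm (I.1.le_max' w hw) h
      · rintro rfl
        exact ⟨I.1.max'_mem I.2, le_rfl⟩
    have h2 : I.1.filter (· ≤ I.1.max' I.2) = I.1 :=
      Finset.filter_true_of_mem fun w hw => I.1.le_max' w hw
    rw [h1, h2]
    simp [evalOn_one]
  · intro v hv hne
    rw [evalOn_one, if_neg, mul_zero]
    intro hc
    obtain ⟨a, ha⟩ := Finset.card_eq_one.1 hc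
    have h1 : v ∈ I.1.filter (v ≤ ·) := by simp [hv]
    have h2 : I.1.max' I.2 ∈ I.1.filter (v ≤ ·) := by
      simp [I.1.max'_mem I.2, I.1.le_max' v hv]
    rw [ha, Finset.mem_singleton] at h1 h2
    exact hne (h1.trans h2.symm)

theorem mul_assoc' (φ ψ χ : Cochain K V) : φ * ψ * χ = φ * (ψ * χ) := by
  ext I
  simp only [mul_apply, evalOn_mul, Finset.sum_mul, Finset.mul_sum]
  rw [Finset.sum_comm' (t' := I.1) (s' := fun v => I.1.filter (v ≤ ·))]
  · refine Finset.sum_congr rfl fun v hv => Finset.sum_congr rfl fun w hw => ?_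
    simp only [Finset.mem_filter] at hw
    have h1 : (I.1.filter (· ≤ w)).filter (· ≤ v) = I.1.filter (· ≤ v) := by
      ext z; simp only [Finset.mem_filter]; grind
    have h2 : (I.1.filter (· ≤ w)).filter (v ≤ ·) = (I.1.filter (v ≤ ·)).filter (· ≤ w) := by
      ext z; simp only [Finset.mem_filter]; grind
    have h3 : (I.1.filter (v ≤ ·)).filter (w ≤ ·) = I.1.filter (w ≤ ·) := by
      ext z; simp only [Finset.mem_filter]; grind
    rw [h1, h2, h3, mul_assoc]
  · intro w v
    simp only [Finset.mem_filter]
    grind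

/-- The cochains of a simplex form an associative unital ring under the cup product. -/
instance : Ring (Cochain K V) :=
  { (inferInstance : AddCommGroup (Cochain K V)) with
    mul := (· * ·)
    one := 1
    mul_assoc := mul_assoc'
    one_mul := one_mul'
    mul_one := mul_one'
    left_distrib := fun a b c => by
      ext I; simp [mul_apply, mul_add, Finset.sum_add_distrib]
    right_distrib := fun a b c => by
      ext I; simp [mul_apply, add_mul, Finset.sum_add_distrib]
    zero_mul := fun a => by ext I; simp [mul_apply]
    mul_zero := fun a => by ext I; simp [mul_apply] }

instance : Algebra K (Cochain K V) :=
  Algebra.ofModule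
    (fun c a b => by ext I; simp [mul_apply, Finset.mul_sum, mul_assoc])
    (fun c a b => by ext I; simp [mul_apply, Finset.mul_sum, mul_left_comm])

/-- The simplicial coboundary: on a face `x` with vertices `x_0 < … < x_m`,
`(dφ)(x) = ∑_k (-1)^k φ(x_0, …, x̂_k, …, x_m)` if `m ≥ 1`, and `(dφ)(x) = 0` if `m = 0`. -/
def d : Cochain K V →ₗ[K] Cochain K V where
  toFun φ I := ∑ v ∈ I.1, (-1) ^ (I.1.filter (· < v)).card * φ.evalOn (I.1.erase v)
  map_add' φ ψ := by
    ext I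
    change _ = (∑ v ∈ I.1, (-1) ^ (I.1.filter (· < v)).card * φ.evalOn (I.1.erase v)) +
      ∑ v ∈ I.1, (-1) ^ (I.1.filter (· < v)).card * ψ.evalOn (I.1.erase v)
    rw [← Finset.sum_add_distrib]
    exact Finset.sum_congr rfl fun v _ => by rw [evalOn_add, mul_add]
  map_smul' c φ := by
    ext I
    change _ = c * ∑ v ∈ I.1, (-1) ^ (I.1.filter (· < v)).card * φ.evalOn (I.1.erase v)
    rw [Finset.mul_sum]
    exact Finset.sum_congr rfl fun v _ => by rw [evalOn_smul, mul_left_comm]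

theorem d_apply (φ : Cochain K V) (I : Face V) :
    d φ I = ∑ v ∈ I.1, (-1) ^ (I.1.filter (· < v)).card * φ.evalOn (I.1.erase v) := rfl

/-- The pullback of normalized cochains along an order preserving map `θ` of vertices:
`(θ^*φ)(x_0, …, x_m) = φ(θ(x_0), …, θ(x_m))`, which is `0` if the latter simplex is degenerate. -/
def pullback (θ : V →o W) : Cochain K W →ₗ[K] Cochain K V where
  toFun φ I := open Classical in if Set.InjOn θ I.1 then φ.evalOn (I.1.image θ) else 0
  map_add' φ ψ := by
    ext I
    change _ = (if _ then φ.evalOn (I.1.image θ) else 0) + if _ then ψ.evalOn (I.1.image θ) else 0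
    rw [evalOn_add]
    by_cases h : Set.InjOn θ I.1
    · simp only [h, if_true]
    · simp only [h, if_false, add_zero]
  map_smul' c φ := by
    ext I
    change _ = c * if _ then φ.evalOn (I.1.image θ) else 0
    rw [evalOn_smul]
    by_cases h : Set.InjOn θ I.1
    · simp only [h, if_true]
    · simp only [h, if_false, mul_zero]

theorem pullback_apply (θ : V →o W) (φ : Cochain K W) (I : Face V) :
    pullback θ φ I = open Classical in if Set.InjOn θ I.1 then φ.evalOn (I.1.image θ) else 0 := rfl

theorem evalOn_pullback (θ : V →o W) (φ : Cochain K W) (s : Finset V) :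
    (pullback θ φ).evalOn s =
      open Classical in if Set.InjOn θ s then φ.evalOn (s.image θ) else 0 := by
  by_cases h : s.Nonempty
  · simp [evalOn, h, pullback_apply]
  · simp only [Finset.not_nonempty_iff_eq_empty] at h
    simp [h]

theorem pullback_id (φ : Cochain K V) : pullback OrderHom.id φ = φ := by
  ext I
  have h : Set.InjOn (OrderHom.id : V →o V) I.1 := fun _ _ _ _ h => h
  rw [pullback_apply, if_pos h]
  simp

theorem pullback_comp (θ : V →o W) (η : W →o U) (φ : Cochain K U) :
    pullback (η.comp θ) φ = pullback θ (pullback η φ) := by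
  classical
  ext I
  simp only [pullback_apply, evalOn_pullback]
  by_cases h : Set.InjOn θ I.1
  · have h2 : Set.InjOn (η.comp θ) I.1 ↔ Set.InjOn η (I.1.image θ) := by
      rw [Finset.coe_image]
      exact ⟨fun h' => Set.InjOn.image_of_comp (f := θ) h',
        fun h' => Set.InjOn.comp (f := θ) (g := η) h' h (Set.mapsTo_image _ _)⟩
    simp only [h, h2, if_true, Finset.image_image]
    rfl
  · rw [if_neg, if_neg h]
    exact fun h' => h (Set.InjOn.of_comp h')

/-- A non injective order preserving map on a finite set identifies two consecutive elements. -/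
theorem exists_consecutive {θ : V →o W} {s : Finset V} (h : ¬ Set.InjOn θ s) :
    ∃ a ∈ s, ∃ b ∈ s, a < b ∧ θ a = θ b ∧ ∀ z ∈ s, z ≤ a ∨ b ≤ z := by
  obtain ⟨a, ha, b, hb, hab, hθ⟩ : ∃ a ∈ s, ∃ b ∈ s, a < b ∧ θ a = θ b := by
    simp only [Set.InjOn] at h
    push Not at h
    obtain ⟨a, ha, b, hb, hθ, hne⟩ := h
    rcases lt_or_gt_of_ne hne with h | h
    · exact ⟨a, ha, b, hb, h, hθ⟩
    · exact ⟨b, hb, a, ha, h, hθ.symm⟩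
  have hne : (s.filter (a < ·)).Nonempty := ⟨b, by simp [hb, hab]⟩
  have hm := Finset.min'_mem _ hne
  simp only [Finset.mem_filter] at hm
  refine ⟨a, ha, (s.filter (a < ·)).min' hne, hm.1, hm.2, ?_, ?_⟩
  · apply le_antisymm (θ.monotone hm.2.le)
    rw [hθ]
    exact θ.monotone (Finset.min'_le _ _ (by simp [hb, hab]))
  · intro z hz
    rcases le_or_gt z a with h | h
    · exact Or.inl h
    · exact Or.inr (Finset.min'_le _ _ (by simp [hz, h]))

theorem pullback_one (θ : V →o W) : pullback θ (1 : Cochain K W) = 1 := by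
  classical
  ext I
  rw [pullback_apply, evalOn_one, one_apply]
  by_cases h : Set.InjOn θ I.1
  · rw [if_pos h, Finset.card_image_of_injOn h]
  · rw [if_neg h, if_neg]
    intro hc
    obtain ⟨a, ha⟩ := Finset.card_eq_one.1 hc
    exact h (by simp [ha])

theorem pullback_mul (θ : V →o W) (φ ψ : Cochain K W) :
    pullback θ (φ * ψ) = pullback θ φ * pullback θ ψ := by
  classical
  ext I
  rw [pullback_apply, mul_apply, evalOn_mul]
  simp only [evalOn_pullback]
  by_cases h : Set.InjOn θ I.1
  · rw [if_pos h, Finset.sum_image h]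
    refine Finset.sum_congr rfl fun v hv => ?_
    have key : ∀ w ∈ I.1, (θ w ≤ θ v ↔ w ≤ v) ∧ (θ v ≤ θ w ↔ v ≤ w) := by
      intro w hw
      refine ⟨⟨fun h' => ?_, fun h' => θ.monotone h'⟩, ⟨fun h' => ?_, fun h' => θ.monotone h'⟩⟩
      · by_contra hc
        exact hc (h hw hv (le_antisymm h' (θ.monotone (not_le.1 hc).le))).le
      · by_contra hc
        exact hc (h hw hv (le_antisymm (θ.monotone (not_le.1 hc).le) h')).ge
    have h1 : (I.1.image θ).filter (· ≤ θ v) = (I.1.filter (· ≤ v)).image θ := by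
      ext z
      simp only [Finset.mem_filter, Finset.mem_image]
      constructor
      · rintro ⟨⟨w, hw, rfl⟩, hz⟩
        exact ⟨w, ⟨hw, (key w hw).1.1 hz⟩, rfl⟩
      · rintro ⟨w, ⟨hw, hz⟩, rfl⟩
        exact ⟨⟨w, hw, rfl⟩, (key w hw).1.2 hz⟩
    have h2 : (I.1.image θ).filter (θ v ≤ ·) = (I.1.filter (v ≤ ·)).image θ := by
      ext z
      simp only [Finset.mem_filter, Finset.mem_image]
      constructor
      · rintro ⟨⟨w, hw, rfl⟩, hz⟩
        exact ⟨w, ⟨hw, (key w hw).2.1 hz⟩, rfl⟩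
      · rintro ⟨w, ⟨hw, hz⟩, rfl⟩
        exact ⟨⟨w, hw, rfl⟩, (key w hw).2.2 hz⟩
    rw [h1, h2, if_pos (h.mono (Finset.coe_subset.2 (Finset.filter_subset _ _))),
      if_pos (h.mono (Finset.coe_subset.2 (Finset.filter_subset _ _)))]
  · rw [if_neg h, eq_comm]
    obtain ⟨a, ha, b, hb, hab, hθ, hc⟩ := exists_consecutive h
    refine Finset.sum_eq_zero fun v hv => ?_
    rcases hc v hv with hv' | hv'
    · rw [if_neg (c := Set.InjOn θ (I.1.filter (v ≤ ·))), mul_zero]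
      intro hi
      exact hab.ne (hi (by simp [ha, hv']) (by simp [hb, hv'.trans hab.le]) hθ)
    · rw [if_neg, zero_mul]
      intro hi
      exact hab.ne (hi (by simp [ha, hab.le.trans hv']) (by simp [hb, hv']) hθ)

theorem pullback_d (θ : V →o W) (φ : Cochain K W) :
    pullback θ (d φ) = d (pullback θ φ) := by
  classical
  ext I
  have hd : ∀ s : Finset W, (d φ).evalOn s =
      ∑ v ∈ s, (-1) ^ (s.filter (· < v)).card * φ.evalOn (s.erase v) := by
    intro s
    by_cases h : s.Nonempty
    · simp [evalOn, h, d_apply]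
    · simp only [Finset.not_nonempty_iff_eq_empty] at h
      simp [h]
  rw [pullback_apply, d_apply, hd]
  simp only [evalOn_pullback]
  by_cases h : Set.InjOn θ I.1
  · rw [if_pos h, Finset.sum_image h]
    refine Finset.sum_congr rfl fun v hv => ?_
    have h1 : (I.1.image θ).filter (· < θ v) = (I.1.filter (· < v)).image θ := by
      ext z
      simp only [Finset.mem_filter, Finset.mem_image]
      constructor
      · rintro ⟨⟨w, hw, rfl⟩, hz⟩
        exact ⟨w, ⟨hw, θ.monotone.reflect_lt hz⟩, rfl⟩
      · rintro ⟨w, ⟨hw, hz⟩, rfl⟩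
        refine ⟨⟨w, hw, rfl⟩, lt_of_le_of_ne (θ.monotone hz.le) fun he => hz.ne (h hw hv he)⟩
    have h2 : (I.1.image θ).erase (θ v) = (I.1.erase v).image θ := by
      ext z
      simp only [Finset.mem_erase, Finset.mem_image]
      constructor
      · rintro ⟨hz, w, hw, rfl⟩
        exact ⟨w, ⟨fun he => hz (by rw [he]), hw⟩, rfl⟩
      · rintro ⟨w, ⟨hz, hw⟩, rfl⟩
        exact ⟨fun he => hz (h hw hv he), w, hw, rfl⟩
    rw [h1, h2, if_pos (h.mono (by simp)),
      Finset.card_image_of_injOn (h.mono (Finset.coe_subset.2 (Finset.filter_subset _ _)))]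
  · rw [if_neg h, eq_comm]
    obtain ⟨a, ha, b, hb, hab, hθ, hc⟩ := exists_consecutive h
    have hsub : ({a, b} : Finset V) ⊆ I.1 := by
      intro z hz
      simp only [Finset.mem_insert, Finset.mem_singleton] at hz
      rcases hz with rfl | rfl <;> assumption
    rw [← Finset.sum_subset hsub, Finset.sum_pair hab.ne]
    · have hcard : (I.1.filter (· < b)).card = (I.1.filter (· < a)).card + 1 := by
        rw [← Finset.card_insert_of_notMem (s := I.1.filter (· < a)) (a := a) (by simp)]
        congr 1
        ext z
        simp only [Finset.mem_filter, Finset.mem_insert]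
        constructor
        · rintro ⟨hz, hzb⟩
          rcases hc z hz with h' | h'
          · rcases h'.eq_or_lt with h'' | h''
            · exact Or.inl h''
            · exact Or.inr ⟨hz, h''⟩
          · exact absurd hzb (not_lt.2 h')
        · rintro (rfl | ⟨hz, hza⟩)
          · exact ⟨ha, hab⟩
          · exact ⟨hz, hza.trans hab⟩
      have himg : (I.1.erase a).image θ = (I.1.erase b).image θ := by
        ext z
        simp only [Finset.mem_image, Finset.mem_erase]
        constructor
        · rintro ⟨w, ⟨hw, hwI⟩, rfl⟩
          by_cases hwb : w = b
          · exact ⟨a, ⟨hab.ne, ha⟩, by rw [hwb, hθ]⟩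
          · exact ⟨w, ⟨hwb, hwI⟩, rfl⟩
        · rintro ⟨w, ⟨hw, hwI⟩, rfl⟩
          by_cases hwa : w = a
          · exact ⟨b, ⟨hab.ne', hb⟩, by rw [hwa, hθ]⟩
          · exact ⟨w, ⟨hwa, hwI⟩, rfl⟩
      have hinj : Set.InjOn θ (I.1.erase a) ↔ Set.InjOn θ (I.1.erase b) := by
        rw [← Finset.card_image_iff, ← Finset.card_image_iff, himg,
          Finset.card_erase_of_mem ha, Finset.card_erase_of_mem hb]
      rw [hcard, himg]
      simp only [hinj]
      ring
    · intro v hv hv'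
      simp only [Finset.mem_insert, Finset.mem_singleton, not_or] at hv'
      rw [if_neg, mul_zero]
      intro hi
      exact hab.ne (hi (by simp [ha, Ne.symm hv'.1]) (by simp [hb, Ne.symm hv'.2]) hθ)

theorem pullback_mem_degreePart (θ : V →o W) {q : ℤ} {φ : Cochain K W}
    (h : φ ∈ degreePart K W q) : pullback θ φ ∈ degreePart K V q := by
  classical
  intro I hI
  rw [pullback_apply]
  by_cases hi : Set.InjOn θ I.1
  · have hne : (I.1.image θ).Nonempty := I.2.image θ
    rw [if_pos hi]
    simp only [evalOn, hne, dif_pos]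
    refine h _ ?_
    simpa [Face.dim, Finset.card_image_of_injOn hi] using hI
  · rw [if_neg hi]

variable (K) in
/-- The pullback is a morphism of algebras for the cup product. -/
def pullbackAlgHom (θ : V →o W) : Cochain K W →ₐ[K] Cochain K V :=
  AlgHom.ofLinearMap (pullback θ) (pullback_one θ) (pullback_mul θ)

end Order

end Cochain

/-! ### Complete shifted `A_∞`-algebras -/

/-- A (curved) complete shifted `A_∞`-algebra structure on a `K`-vector space `A`: a `ℤ`-grading, a
decreasing separated complete filtration `A = F¹A ⊇ F²A ⊇ …` by graded subspaces, and multilinear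
operations `Q_n : A^{⊗n} → A` of degree `+1` for `n ≥ 0` that preserve the filtration and satisfy
`∑_{a+b+c=n} Q_{a+1+c} ∘ (id^{⊗a} ⊗ Q_b ⊗ id^{⊗c}) = 0` for all `n ≥ 0`, with Koszul signs. The term
`Q_0` is the curvature. -/
structure CompleteShiftedAInfinity (K : Type u) [Field K] (A : Type v) [AddCommGroup A]
    [Module K A] where
  /-- The homogeneous elements of degree `p`. -/
  deg : ℤ → Submodule K A
  /-- `A` is the direct sum of its homogeneous parts. -/
  decomposition : DirectSum.Decomposition deg
  /-- The filtration. The index `0` is a convenience: `F⁰A = F¹A = A`. -/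
  fil : ℕ → Submodule K A
  fil_one : fil 1 = ⊤
  fil_antitone : Antitone fil
  fil_homogeneous : ∀ k, ∀ a ∈ fil k, ∀ p, (DirectSum.decompose deg a p : A) ∈ fil k
  fil_separated : ⨅ k, fil k = ⊥
  /-- Every Cauchy sequence of homogeneous elements of the same degree converges. -/
  fil_complete : ∀ (p : ℤ) (s : ℕ → A), (∀ m, s m ∈ deg p) →
    (∀ k, ∃ N, ∀ m ≥ N, ∀ m' ≥ N, s m - s m' ∈ fil k) →
    ∃ a ∈ deg p, ∀ k, ∃ N, ∀ m ≥ N, s m - a ∈ fil k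
  /-- The operations. -/
  Q : ∀ n : ℕ, MultilinearMap K (fun _ : Fin n => A) A
  Q_deg : ∀ (n : ℕ) (e : Fin n → ℤ) (x : Fin n → A), (∀ i, x i ∈ deg (e i)) →
    Q n x ∈ deg (∑ i, e i + 1)
  Q_fil : ∀ (n : ℕ) (k : Fin n → ℕ) (x : Fin n → A), (∀ i, x i ∈ fil (k i)) →
    Q n x ∈ fil (∑ i, k i)
  /-- The `A_∞`-relation of arity `n`, evaluated on homogeneous elements `x_0, …, x_{n-1}` of degrees
  `e_0, …, e_{n-1}` (the first `n` terms of two sequences). -/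
  relation : ∀ (n : ℕ) (e : ℕ → ℤ) (x : ℕ → A), (∀ i, x i ∈ deg (e i)) →
    ∑ abc ∈ Finset.Nat.antidiagonalTuple 3 n,
      (∑ i ∈ Finset.range (abc 0), e i).negOnePow •
        Q (abc 0 + 1 + abc 2) (fun j =>
          if (j : ℕ) < abc 0 then x j
          else if (j : ℕ) = abc 0 then Q (abc 1) (fun i => x (abc 0 + i))
          else x (j - 1 + abc 1)) = 0

attribute [instance] CompleteShiftedAInfinity.decomposition

/-- `x` is a Maurer-Cartan element: it has degree `0` and its curvature `∑_{l ≥ 0} Q_l(x, …, x)`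
vanishes, the series being taken in the topology defined by the filtration. -/
def IsMaurerCartan {K : Type u} [Field K] {M : Type v} [AddCommGroup M] [Module K M]
    (deg : ℤ → Submodule K M) (fil : ℕ → Submodule K M)
    (Q : ∀ n : ℕ, MultilinearMap K (fun _ : Fin n => M) M) (x : M) : Prop :=
  x ∈ deg 0 ∧ ∀ k, ∃ N, ∀ m ≥ N, ∑ l ∈ Finset.range m, Q l (fun _ => x) ∈ fil k

namespace CompleteShiftedAInfinity

section Extension

variable {K : Type u} [Field K] {A : Type v} [AddCommGroup A] [Module K A]
  (S : CompleteShiftedAInfinity K A)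

/-- The linear map `a ↦ (-1)^{m|a|} a`. -/
def koszul (m : ℤ) : A →ₗ[K] A :=
  (DirectSum.toModule K ℤ A fun p => (m * p).negOnePow • (S.deg p).subtype) ∘ₗ
    (DirectSum.decomposeLinearEquiv S.deg).toLinearMap

theorem koszul_of_mem (m : ℤ) {p : ℤ} {a : A} (ha : a ∈ S.deg p) :
    S.koszul m a = (m * p).negOnePow • a := by
  rw [koszul, LinearMap.comp_apply, LinearEquiv.coe_coe, DirectSum.decomposeLinearEquiv_apply,
    DirectSum.decompose_of_mem _ ha, ← DirectSum.lof_eq_of K, DirectSum.toModule_lof]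
  rfl

variable (V W U : Type) [LinearOrder V] [LinearOrder W] [LinearOrder U]

/-- The homogeneous elements of degree `m` of `A ⊗ N^•`: sums of tensors `a ⊗ φ` with
`|a| + |φ| = m`. -/
def tensorDeg (m : ℤ) : Submodule K (A ⊗[K] Cochain K V) :=
  ⨆ p : ℤ, Submodule.map₂ (TensorProduct.mk K A (Cochain K V)) (S.deg p)
    (Cochain.degreePart K V (m - p))

/-- The filtration `F^k(A ⊗ N^•) = F^kA ⊗ N^•`. -/
def tensorFil (k : ℕ) : Submodule K (A ⊗[K] Cochain K V) :=
  Submodule.map₂ (TensorProduct.mk K A (Cochain K V)) (S.fil k) ⊤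

variable (K A) {V} in
/-- The coefficient `x_I ∈ A` of `x = ∑_I x_I ⊗ φ_I`. -/
def coeff (I : Face V) : A ⊗[K] Cochain K V →ₗ[K] A :=
  (TensorProduct.rid K A).toLinearMap ∘ₗ LinearMap.lTensor A (LinearMap.proj I : (Face V → K) →ₗ[K] K)

/-- The operation `Q_l ⊗ ∪^{(l)}` on `(A ⊗ N^•)^{⊗l} ≅ A^{⊗l} ⊗ (N^•)^{⊗l}`, the isomorphism being
taken with the Koszul sign rule:
`(a_1 ⊗ φ_1, …, a_l ⊗ φ_l) ↦ ± Q_l(a_1, …, a_l) ⊗ (φ_1 ∪ … ∪ φ_l)`, where the sign is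
`(-1)^{∑_{i<j} |φ_i||a_j|}`. It is written in the basis `φ_I` of the cochains. -/
def tensorOp [Fintype V] (l : ℕ) :
    MultilinearMap K (fun _ : Fin l => A ⊗[K] Cochain K V) (A ⊗[K] Cochain K V) :=
  ∑ I : Fin l → Face V,
    ((TensorProduct.mk K A (Cochain K V)).flip
        (List.ofFn fun j => (Cochain.basisCochain (I j) : Cochain K V)).prod).compMultilinearMap
      ((S.Q l).compLinearMap fun j => S.koszul (∑ i ∈ Finset.Iio j, (I i).dim) ∘ₗ coeff K A (I j))

/-- The map `id ⊗ d` on `A ⊗ N^•`, that is `a ⊗ φ ↦ (-1)^{|a|} a ⊗ dφ`. -/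
def tensorD : A ⊗[K] Cochain K V →ₗ[K] A ⊗[K] Cochain K V :=
  TensorProduct.map (S.koszul 1) Cochain.d

/-- The operations `NQ_l` of the extension of scalars of `A` by the cochains of a simplex:
`NQ_0(1) = Q_0(1) ⊗ 𝟙`, `NQ_1 = Q_1 ⊗ id + id ⊗ d`, and `NQ_l = Q_l ⊗ ∪^{(l)}` for `l ≥ 2`. -/
def tensorQ [Fintype V] : ∀ l : ℕ,
    MultilinearMap K (fun _ : Fin l => A ⊗[K] Cochain K V) (A ⊗[K] Cochain K V)
  | 0 => S.tensorOp V 0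
  | 1 => S.tensorOp V 1 + MultilinearMap.ofSubsingleton K _ _ (0 : Fin 1) (S.tensorD V)
  | (l + 2) => S.tensorOp V (l + 2)

variable {V W U}

@[simp] theorem coeff_tmul (I : Face V) (a : A) (φ : Cochain K V) :
    coeff K A I (a ⊗ₜ[K] φ) = φ I • a := by
  simp only [coeff, LinearMap.comp_apply, LinearEquiv.coe_coe]
  rfl

theorem sum_basisCochain [Fintype V] (φ : Cochain K V) :
    φ = ∑ I : Face V, φ I • (Cochain.basisCochain I : Cochain K V) := by
  classical
  have h := pi_eq_sum_univ (R := K) (ι := Face V) φ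
  refine h.trans (Finset.sum_congr rfl fun I _ => ?_)
  congr 1
  funext J
  simp [Cochain.basisCochain, Pi.single_apply, eq_comm]

theorem basisCochain_mem (I : Face V) :
    (Cochain.basisCochain I : Cochain K V) ∈ Cochain.degreePart K V I.dim := by
  classical
  intro J hJ
  have : J ≠ I := fun h => hJ (by rw [h])
  simp [Cochain.basisCochain, this]

theorem sum_coeff [Fintype V] (x : A ⊗[K] Cochain K V) :
    x = ∑ I : Face V, coeff K A I x ⊗ₜ[K] (Cochain.basisCochain I : Cochain K V) := by
  induction x with
  | zero => simp
  | add x y hx hy =>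
    conv_lhs => rw [hx, hy]
    simp only [map_add, TensorProduct.add_tmul, Finset.sum_add_distrib]
  | tmul a φ =>
    conv_lhs => rw [sum_basisCochain φ]
    simp only [coeff_tmul, TensorProduct.tmul_sum, TensorProduct.smul_tmul]

theorem tensorOp_apply [Fintype V] (l : ℕ) (x : Fin l → A ⊗[K] Cochain K V) :
    S.tensorOp V l x = ∑ I : Fin l → Face V,
      S.Q l (fun j => S.koszul (∑ i ∈ Finset.Iio j, (I i).dim) (coeff K A (I j) (x j))) ⊗ₜ[K]
        (List.ofFn fun j => (Cochain.basisCochain (I j) : Cochain K V)).prod := by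
  rw [tensorOp, sum_apply]
  rfl

/-- `tensorOp` on elementary tensors with homogeneous second factors. -/
theorem tensorOp_tmul [Fintype V] (l : ℕ) (a : Fin l → A) (q : Fin l → ℤ) (c : Fin l → Cochain K V)
    (hc : ∀ j, c j ∈ Cochain.degreePart K V (q j)) :
    S.tensorOp V l (fun j => a j ⊗ₜ[K] c j) =
      S.Q l (fun j => S.koszul (∑ i ∈ Finset.Iio j, q i) (a j)) ⊗ₜ[K] (List.ofFn c).prod := by
  have hprod : (List.ofFn c).prod = ∑ I : Fin l → Face V,
      (∏ j, c j (I j)) • (List.ofFn fun j => (Cochain.basisCochain (I j) : Cochain K V)).prod := by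
    have h := (MultilinearMap.mkPiAlgebraFin K l (Cochain K V)).map_sum
      (fun j (I : Face V) => c j I • (Cochain.basisCochain I : Cochain K V))
    simp only [← sum_basisCochain, MultilinearMap.map_smul_univ] at h
    simpa using h
  rw [hprod, TensorProduct.tmul_sum, tensorOp_apply]
  refine Finset.sum_congr rfl fun I _ => ?_
  simp only [coeff_tmul, map_smul]
  rw [MultilinearMap.map_smul_univ, ← TensorProduct.smul_tmul]
  by_cases h : ∀ j, (I j).dim = q j
  · simp only [h]
  · push Not at h
    obtain ⟨j, hj⟩ := h
    have : ∏ j, c j (I j) = 0 := Finset.prod_eq_zero (Finset.mem_univ j) (hc j (I j) hj)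
    simp [this]

/-- The map `id ⊗ θ^*` on `A ⊗ N^•`. -/
def tensorPullback (θ : V →o W) : A ⊗[K] Cochain K W →ₗ[K] A ⊗[K] Cochain K V :=
  LinearMap.lTensor A (Cochain.pullback θ)

theorem tensorPullback_tmul (θ : V →o W) (a : A) (φ : Cochain K W) :
    tensorPullback θ (a ⊗ₜ[K] φ) = a ⊗ₜ[K] Cochain.pullback θ φ := rfl

theorem tensorPullback_tensorOp [Fintype V] [Fintype W] (θ : V →o W) (l : ℕ) (x : Fin l → A ⊗[K] Cochain K W) :
    S.tensorOp V l (fun j => tensorPullback θ (x j)) = tensorPullback θ (S.tensorOp W l x) := by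
  have hx : ∀ j, tensorPullback (A := A) θ (x j) = ∑ I : Face W,
      coeff K A I (x j) ⊗ₜ[K] Cochain.pullback θ (Cochain.basisCochain I : Cochain K W) := by
    intro j
    conv_lhs => rw [sum_coeff (x j)]
    simp only [map_sum, tensorPullback_tmul]
  simp only [hx]
  rw [MultilinearMap.map_sum, S.tensorOp_apply l x, map_sum]
  refine Finset.sum_congr rfl fun I _ => ?_
  rw [S.tensorOp_tmul l _ (fun j => (I j).dim) _
    fun j => Cochain.pullback_mem_degreePart θ (basisCochain_mem (I j))]
  rw [tensorPullback_tmul]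
  congr 1
  have h := map_list_prod (Cochain.pullbackAlgHom K θ)
    (List.ofFn fun j => (Cochain.basisCochain (I j) : Cochain K W))
  rw [List.map_ofFn] at h
  exact h.symm

theorem tensorPullback_tensorD (θ : V →o W) (x : A ⊗[K] Cochain K W) :
    S.tensorD V (tensorPullback θ x) = tensorPullback θ (S.tensorD W x) := by
  induction x with
  | zero => simp
  | add x y hx hy => simp only [map_add, hx, hy]
  | tmul a φ =>
    simp only [tensorPullback_tmul, tensorD, TensorProduct.map_tmul, Cochain.pullback_d]

theorem tensorPullback_tensorQ [Fintype V] [Fintype W] (θ : V →o W) (l : ℕ) (x : Fin l → A ⊗[K] Cochain K W) :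
    S.tensorQ V l (fun j => tensorPullback θ (x j)) = tensorPullback θ (S.tensorQ W l x) := by
  match l with
  | 0 => exact S.tensorPullback_tensorOp θ 0 x
  | 1 =>
    simp only [tensorQ, add_apply, map_add, S.tensorPullback_tensorOp θ 1 x,
      MultilinearMap.ofSubsingleton_apply_apply, tensorPullback_tensorD]
  | (l + 2) => exact S.tensorPullback_tensorOp θ (l + 2) x

theorem tensorPullback_mem_tensorDeg (θ : V →o W) (m : ℤ) {x : A ⊗[K] Cochain K W}
    (hx : x ∈ S.tensorDeg W m) : tensorPullback θ x ∈ S.tensorDeg V m := by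
  suffices h : S.tensorDeg W m ≤ (S.tensorDeg V m).comap (tensorPullback θ) from h hx
  refine iSup_le fun p => Submodule.map₂_le.2 fun a ha φ hφ => ?_
  exact Submodule.mem_iSup_of_mem p
    (Submodule.apply_mem_map₂ _ ha (Cochain.pullback_mem_degreePart θ hφ))

theorem tensorPullback_mem_tensorFil (θ : V →o W) (k : ℕ) {x : A ⊗[K] Cochain K W}
    (hx : x ∈ S.tensorFil W k) : tensorPullback θ x ∈ S.tensorFil V k := by
  suffices h : S.tensorFil W k ≤ (S.tensorFil V k).comap (tensorPullback θ) from h hx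
  exact Submodule.map₂_le.2 fun a ha φ _ => Submodule.apply_mem_map₂ _ ha Submodule.mem_top

theorem tensorPullback_isMaurerCartan [Fintype V] [Fintype W] (θ : V →o W) {x : A ⊗[K] Cochain K W}
    (hx : IsMaurerCartan (S.tensorDeg W) (S.tensorFil W) (S.tensorQ W) x) :
    IsMaurerCartan (S.tensorDeg V) (S.tensorFil V) (S.tensorQ V) (tensorPullback θ x) := by
  refine ⟨S.tensorPullback_mem_tensorDeg θ 0 hx.1, fun k => ?_⟩
  obtain ⟨N, hN⟩ := hx.2 k
  refine ⟨N, fun m hm => ?_⟩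
  simp only [S.tensorPullback_tensorQ θ _ (fun _ => x), ← map_sum]
  exact S.tensorPullback_mem_tensorFil θ k (hN m hm)

theorem tensorPullback_id (x : A ⊗[K] Cochain K V) : tensorPullback OrderHom.id x = x := by
  induction x with
  | zero => simp
  | add x y hx hy => simp only [map_add, hx, hy]
  | tmul a φ => rw [tensorPullback_tmul, Cochain.pullback_id]

theorem tensorPullback_comp (θ : V →o W) (η : W →o U) (x : A ⊗[K] Cochain K U) :
    tensorPullback (η.comp θ) x = tensorPullback θ (tensorPullback η x) := by
  induction x with
  | zero => simp
  | add x y hx hy => simp only [map_add, hx, hy]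
  | tmul a φ => simp only [tensorPullback_tmul, Cochain.pullback_comp]

end Extension

section MaurerCartan

variable {K : Type u} [Field K] {A B : Type v} [AddCommGroup A] [Module K A]
  [AddCommGroup B] [Module K B]

/-- The Maurer-Cartan simplicial set `MC_•(A, Q)`: its `n`-simplices are the Maurer-Cartan elements
of `A ⊗ N^•(Δⁿ)`, and its faces and degeneracies are induced by the pullback of cochains. -/
def mcSSet (S : CompleteShiftedAInfinity K A) : SSet.{max u v} where
  obj n := {x : A ⊗[K] Cochain K (Fin (n.unop.len + 1)) //
    IsMaurerCartan (S.tensorDeg _) (S.tensorFil _) (S.tensorQ _) x}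
  map θ := ↾fun x => ⟨tensorPullback (SimplexCategory.Hom.toOrderHom θ.unop) x.1,
    S.tensorPullback_isMaurerCartan _ x.2⟩
  map_id n := by
    refine ConcreteCategory.hom_ext _ _ fun x => ?_
    exact Subtype.ext (tensorPullback_id x.1)
  map_comp θ η := by
    refine ConcreteCategory.hom_ext _ _ fun x => ?_
    exact Subtype.ext (tensorPullback_comp _ _ x.1)

/-- A strict morphism of complete shifted `A_∞`-algebras: a degree `0` linear map that respects the
filtrations and satisfies `P_n ∘ f^{⊗n} = f ∘ Q_n` for all `n ≥ 0`. -/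
structure StrictHom (S : CompleteShiftedAInfinity K A) (T : CompleteShiftedAInfinity K B) where
  /-- The underlying linear map. -/
  toLinearMap : A →ₗ[K] B
  map_deg : ∀ p, ∀ a ∈ S.deg p, toLinearMap a ∈ T.deg p
  map_fil : ∀ k, ∀ a ∈ S.fil k, toLinearMap a ∈ T.fil k
  map_Q : ∀ (n : ℕ) (x : Fin n → A), T.Q n (fun i => toLinearMap (x i)) = toLinearMap (S.Q n x)

namespace StrictHom

variable {S : CompleteShiftedAInfinity K A} {T : CompleteShiftedAInfinity K B}
  (f : StrictHom S T) {V W : Type} [LinearOrder V] [LinearOrder W]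

theorem koszul_map (m : ℤ) (a : A) :
    T.koszul m (f.toLinearMap a) = f.toLinearMap (S.koszul m a) := by
  induction a using DirectSum.Decomposition.inductionOn S.deg with
  | zero => simp
  | @homogeneous p a =>
    rw [S.koszul_of_mem m a.2, T.koszul_of_mem m (f.map_deg p _ a.2)]
    simp only [Units.smul_def, map_zsmul]
  | add x y hx hy => simp only [map_add, hx, hy]

variable (V) in
/-- The map `f ⊗ id` on `A ⊗ N^•`. -/
def tensor : A ⊗[K] Cochain K V →ₗ[K] B ⊗[K] Cochain K V :=
  LinearMap.rTensor (Cochain K V) f.toLinearMap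

theorem tensor_tmul (a : A) (φ : Cochain K V) :
    f.tensor V (a ⊗ₜ[K] φ) = f.toLinearMap a ⊗ₜ[K] φ := rfl

theorem coeff_tensor (I : Face V) (x : A ⊗[K] Cochain K V) :
    coeff K B I (f.tensor V x) = f.toLinearMap (coeff K A I x) := by
  induction x with
  | zero => simp
  | add x y hx hy => simp only [map_add, hx, hy]
  | tmul a φ => simp [tensor_tmul]

theorem tensor_tensorOp [Fintype V] (l : ℕ) (x : Fin l → A ⊗[K] Cochain K V) :
    T.tensorOp V l (fun j => f.tensor V (x j)) = f.tensor V (S.tensorOp V l x) := by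
  simp only [tensorOp_apply, map_sum, coeff_tensor, koszul_map, f.map_Q, tensor_tmul]

theorem tensor_tensorD (x : A ⊗[K] Cochain K V) :
    T.tensorD V (f.tensor V x) = f.tensor V (S.tensorD V x) := by
  induction x with
  | zero => simp
  | add x y hx hy => simp only [map_add, hx, hy]
  | tmul a φ => simp only [tensorD, tensor_tmul, TensorProduct.map_tmul, koszul_map]

theorem tensor_tensorQ [Fintype V] (l : ℕ) (x : Fin l → A ⊗[K] Cochain K V) :
    T.tensorQ V l (fun j => f.tensor V (x j)) = f.tensor V (S.tensorQ V l x) := by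
  match l with
  | 0 => exact f.tensor_tensorOp 0 x
  | 1 =>
    simp only [tensorQ, add_apply, map_add, f.tensor_tensorOp 1 x,
      MultilinearMap.ofSubsingleton_apply_apply, tensor_tensorD]
  | (l + 2) => exact f.tensor_tensorOp (l + 2) x

theorem tensor_isMaurerCartan [Fintype V] {x : A ⊗[K] Cochain K V}
    (hx : IsMaurerCartan (S.tensorDeg V) (S.tensorFil V) (S.tensorQ V) x) :
    IsMaurerCartan (T.tensorDeg V) (T.tensorFil V) (T.tensorQ V) (f.tensor V x) := by
  constructor
  · suffices h : S.tensorDeg V 0 ≤ (T.tensorDeg V 0).comap (f.tensor V) from h hx.1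
    refine iSup_le fun p => Submodule.map₂_le.2 fun a ha φ hφ => ?_
    exact Submodule.mem_iSup_of_mem p (Submodule.apply_mem_map₂ _ (f.map_deg p a ha) hφ)
  · intro k
    obtain ⟨N, hN⟩ := hx.2 k
    refine ⟨N, fun m hm => ?_⟩
    simp only [f.tensor_tensorQ _ (fun _ => x), ← map_sum]
    suffices h : S.tensorFil V k ≤ (T.tensorFil V k).comap (f.tensor V) from h (hN m hm)
    exact Submodule.map₂_le.2 fun a ha φ _ =>
      Submodule.apply_mem_map₂ _ (f.map_fil k a ha) Submodule.mem_top

theorem tensor_tensorPullback (θ : V →o W) (x : A ⊗[K] Cochain K W) :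
    f.tensor V (tensorPullback θ x) = tensorPullback θ (f.tensor W x) := by
  induction x with
  | zero => simp
  | add x y hx hy => simp only [map_add, hx, hy]
  | tmul a φ => rfl

/-- The simplicial map `MC_•(A, Q) → MC_•(B, P)` induced by a strict morphism `f`, given by
`x ↦ (f ⊗ id)(x)` on `n`-simplices. -/
def mcMap : S.mcSSet ⟶ T.mcSSet where
  app n := ↾fun x => ⟨f.tensor _ x.1, f.tensor_isMaurerCartan x.2⟩
  naturality n m θ := by
    refine ConcreteCategory.hom_ext _ _ fun x => ?_
    exact Subtype.ext (f.tensor_tensorPullback _ x.1)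

end StrictHom

end MaurerCartan

end CompleteShiftedAInfinity

end AInfinity

end

/-! Lifting against the horn Λ[n+1,i] means finding a Maurer-Cartan element `x` over a given `y`
whose faces opposite to the vertices j ≠ i are prescribed. Write `x` as a sum of coefficients `x_I ⊗
φ_I`. The horn fixes all coefficients except two: the one on the top simplex `J` and the one on its
facet `F` opposite to `i`. The top coefficient is any homogeneous lift of that of `y`. This is the
only use of surjectivity, and no control of the lift in the filtration is needed, because A = F¹A.

The coefficient `a` on `F` is forced. The `J`-component of the curvature depends on `a` through the
coboundary term, which is `a` up to sign, and through terms with at least one further argument,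
which gain one step of filtration. Successive approximation therefore solves the Maurer-Cartan
equation on `J` (`exists_facet_value`), and separatedness makes the solution unique
(`facet_value_unique`). Only signs have to be inverted, so the characteristic plays no role.

The equation on `F` itself then comes for free. The Bianchi identity `∑ NQ(x, …, C, …, x) = 0` for
the curvature `C`, read on `J`, expresses the coefficient of `C` on `F` by terms already known to be
small or of higher filtration (`coeff_curvature_facet_mem_fil`). Finally `f x` and `y` agree off `F`
and both satisfy the equation on `J`, so they are equal by uniqueness in the target.

The Bianchi identity rests on the A_∞-relations of `A ⊗ N^•` (`sum_insertSeq_tensorQ`). These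
combine the relations of `A`, the associativity of the cup product, the Leibniz rule and `d ∘ d =
0`, with all Koszul signs. -/

noncomputable section

namespace AInfinity

/-! ### Normalized cochains as a differential graded algebra. -/

namespace Cochain

variable {K : Type u} [Field K] {V : Type} [LinearOrder V]

theorem evalOn_d (φ : Cochain K V) (s : Finset V) :
    (d φ).evalOn s = ∑ v ∈ s, (-1) ^ (s.filter (· < v)).card * φ.evalOn (s.erase v) := by
  by_cases h : s.Nonempty
  · simp [evalOn, h, d_apply]
  · simp only [Finset.not_nonempty_iff_eq_empty] at h
    simp [h]

theorem card_filter_lt_erase_of_lt {s : Finset V} {v w : V} (hv : v ∈ s) (h : v < w) :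
    ((s.erase v).filter (· < w)).card + 1 = (s.filter (· < w)).card := by
  rw [Finset.filter_erase]
  exact Finset.card_erase_add_one (by simp [hv, h])

theorem filter_lt_erase_of_le {s : Finset V} {v w : V} (h : w ≤ v) :
    (s.erase v).filter (· < w) = s.filter (· < w) := by
  rw [Finset.filter_erase]
  exact Finset.erase_eq_of_notMem (by simp [h])

/-- Deleting two distinct vertices in either order gives the same face with opposite signs, so
swapping the ordered pair is a cancelling involution. -/
theorem d_d (φ : Cochain K V) : d (d φ) = 0 := by
  ext I
  rw [d_apply, zero_apply]
  simp only [evalOn_d, Finset.mul_sum]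
  rw [Finset.sum_sigma']
  have key : ∀ v w : V, v ∈ I.1 → v < w →
      (-1) ^ (I.1.filter (· < v)).card *
        ((-1) ^ ((I.1.erase v).filter (· < w)).card * φ.evalOn ((I.1.erase v).erase w)) +
      (-1) ^ (I.1.filter (· < w)).card *
        ((-1) ^ ((I.1.erase w).filter (· < v)).card * φ.evalOn ((I.1.erase w).erase v)) = 0 := by
    intro v w hv h
    rw [← card_filter_lt_erase_of_lt hv h, filter_lt_erase_of_le h.le,
      Finset.erase_right_comm (a := w)]
    ring
  refine Finset.sum_involution (fun p _ => ⟨p.2, p.1⟩) ?_ ?_ ?_ ?_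
  · rintro ⟨v, w⟩ h
    simp only [Finset.mem_sigma, Finset.mem_erase] at h
    rcases lt_or_gt_of_ne h.2.1 with h' | h'
    · rw [add_comm]
      exact key w v h.2.2 h'
    · exact key v w h.1 h'
  · rintro ⟨v, w⟩ h _ he
    simp only [Finset.mem_sigma, Finset.mem_erase] at h
    exact h.2.1 (congrArg Sigma.fst he)
  · rintro ⟨v, w⟩ h
    simp only [Finset.mem_sigma, Finset.mem_erase] at h ⊢
    exact ⟨h.2.2, h.2.1.symm, h.1⟩
  · rintro ⟨v, w⟩ h
    rfl

/-- A telescoping sum along the initial segments of a finite linearly ordered set. -/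
theorem sum_initial_segments (G : Finset V → K) (s : Finset V) :
    ∑ w ∈ s, (-1) ^ (s.filter (· < w)).card * (G (s.filter (· < w)) + G (s.filter (· ≤ w))) =
      G ∅ - (-1) ^ s.card * G s := by
  induction s using Finset.induction_on_max with
  | empty => simp
  | insert a s ha ih =>
    have hn : a ∉ s := fun h => (ha a h).false
    have h1 : ∀ w ∈ s, (insert a s).filter (· < w) = s.filter (· < w) := by
      intro w hw
      rw [Finset.filter_insert, if_neg (ha w hw).not_gt]
    have h2 : ∀ w ∈ s, (insert a s).filter (· ≤ w) = s.filter (· ≤ w) := by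
      intro w hw
      rw [Finset.filter_insert, if_neg (ha w hw).not_ge]
    have h3 : (insert a s).filter (· < a) = s := by
      rw [Finset.filter_insert, if_neg (lt_irrefl a)]
      exact Finset.filter_true_of_mem ha
    have h4 : (insert a s).filter (· ≤ a) = insert a s := by
      refine Finset.filter_true_of_mem fun w hw => ?_
      rcases Finset.mem_insert.1 hw with rfl | hw
      · exact le_rfl
      · exact (ha w hw).le
    rw [Finset.sum_insert hn, h3, h4, Finset.card_insert_of_notMem hn]
    rw [Finset.sum_congr rfl fun w hw => by rw [h1 w hw, h2 w hw], ih]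
    ring

/-- The initial and final segments cut at `v` cover the face and share only `v`, so their dimensions
add up to that of the face. -/
theorem mul_mem_degreePart {p q : ℤ} {φ ψ : Cochain K V} (hφ : φ ∈ degreePart K V p)
    (hψ : ψ ∈ degreePart K V q) : φ * ψ ∈ degreePart K V (p + q) := by
  intro I hI
  rw [mul_apply]
  refine Finset.sum_eq_zero fun v hv => ?_
  have h1 : (I.1.filter (· ≤ v)).Nonempty := ⟨v, by simp [hv]⟩
  have h2 : (I.1.filter (v ≤ ·)).Nonempty := ⟨v, by simp [hv]⟩
  simp only [evalOn, h1, h2, dif_pos]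
  by_contra hc
  have e1 : Face.dim ⟨_, h1⟩ = p := by
    by_contra h
    exact hc (by rw [hφ _ h, zero_mul])
  have e2 : Face.dim ⟨_, h2⟩ = q := by
    by_contra h
    exact hc (by rw [hψ _ h, mul_zero])
  apply hI
  have hu : I.1.filter (· ≤ v) ∪ I.1.filter (v ≤ ·) = I.1 := by
    ext w
    simp only [Finset.mem_union, Finset.mem_filter]
    have := le_total w v
    tauto
  have hi : I.1.filter (· ≤ v) ∩ I.1.filter (v ≤ ·) = {v} := by
    ext w
    simp only [Finset.mem_inter, Finset.mem_filter, Finset.mem_singleton]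
    constructor
    · rintro ⟨⟨_, h⟩, _, h'⟩
      exact le_antisymm h h'
    · rintro rfl
      exact ⟨⟨hv, le_rfl⟩, hv, le_rfl⟩
  have := Finset.card_union_add_card_inter (I.1.filter (· ≤ v)) (I.1.filter (v ≤ ·))
  rw [hu, hi, Finset.card_singleton] at this
  simp only [Face.dim] at e1 e2 ⊢
  omega

theorem one_mem_degreePart {V : Type} : (1 : Cochain K V) ∈ degreePart K V 0 := by
  intro I hI
  rw [one_apply, if_neg]
  intro h
  exact hI (by simp [Face.dim, h])

theorem d_mem_degreePart {q : ℤ} {φ : Cochain K V} (hφ : φ ∈ degreePart K V q) :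
    d φ ∈ degreePart K V (q + 1) := by
  intro I hI
  rw [d_apply]
  refine Finset.sum_eq_zero fun v hv => ?_
  by_cases h : (I.1.erase v).Nonempty
  · simp only [evalOn, h, dif_pos]
    rw [hφ, mul_zero]
    intro he
    apply hI
    have := Finset.card_erase_add_one hv
    simp only [Face.dim] at he ⊢
    omega
  · rw [Finset.not_nonempty_iff_eq_empty.1 h, evalOn_empty, mul_zero]

/-- The Leibniz rule for the cup product. -/
theorem d_mul {q : ℤ} {φ : Cochain K V} (hφ : φ ∈ degreePart K V q) (ψ : Cochain K V) :
    d (φ * ψ) = d φ * ψ + q.negOnePow • (φ * d ψ) := by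
  ext I
  -- The factor of `φ` vanishes unless exactly `q` vertices precede `w`, so the Leibniz sign may be
  -- replaced by a sign depending only on `w`.
  have hsign : ∀ w ∈ I.1, ((q.negOnePow : ℤ) : K) * φ.evalOn (I.1.filter (· ≤ w)) =
      (-1) ^ (I.1.filter (· < w)).card * φ.evalOn (I.1.filter (· ≤ w)) := by
    intro w hw
    have hne : (I.1.filter (· ≤ w)).Nonempty := ⟨w, by simp [hw]⟩
    by_cases h : Face.dim ⟨_, hne⟩ = q
    · have hc : (I.1.filter (· ≤ w)).card = (I.1.filter (· < w)).card + 1 := by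
        rw [← Finset.card_insert_of_notMem (s := I.1.filter (· < w)) (a := w) (by simp)]
        congr 1
        ext z
        simp only [Finset.mem_filter, Finset.mem_insert, le_iff_eq_or_lt]
        constructor
        · rintro ⟨hz, rfl | h⟩
          · exact Or.inl rfl
          · exact Or.inr ⟨hz, h⟩
        · rintro (rfl | ⟨hz, h⟩)
          · exact ⟨hw, Or.inl rfl⟩
          · exact ⟨hz, Or.inr h⟩
      have : q = ((I.1.filter (· < w)).card : ℕ) := by
        rw [← h]; simp only [Face.dim, hc]; push_cast; ring
      rw [this]
      congr 1
      rw [Int.negOnePow_def]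
      simp
    · have : φ.evalOn (I.1.filter (· ≤ w)) = 0 := by
        simp only [evalOn, hne, dif_pos]
        exact hφ _ h
      rw [this, mul_zero, mul_zero]
  have hsm : (q.negOnePow • (φ * d ψ)) I = ((q.negOnePow : ℤ) : K) * (φ * d ψ) I := by
    rw [Units.smul_def, ← Int.cast_smul_eq_zsmul K, smul_apply]
  rw [add_apply, hsm, d_apply, mul_apply, mul_apply]
  simp only [evalOn_d, evalOn_mul, Finset.mul_sum, Finset.sum_mul, ← mul_assoc]
  have hsign' : ∀ w ∈ I.1, ∀ z : K, ∀ y : K,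
      ((q.negOnePow : ℤ) : K) * φ.evalOn (I.1.filter (· ≤ w)) * y * z =
      (-1) ^ (I.1.filter (· < w)).card * φ.evalOn (I.1.filter (· ≤ w)) * y * z := by
    intro w hw z y
    rw [hsign w hw]
  rw [Finset.sum_congr (s₂ := I.1) rfl fun w hw => Finset.sum_congr rfl fun v _ =>
    hsign' w hw _ _]
  -- In `d (φ * ψ)` the deleted vertex `v` differs from the cut `w`, so it lies strictly inside the
  -- `φ` part or strictly inside the `ψ` part.
  have hL : ∑ v ∈ I.1, ∑ w ∈ I.1.erase v, (-1) ^ (I.1.filter (· < v)).card *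
      φ.evalOn ((I.1.erase v).filter (· ≤ w)) * ψ.evalOn ((I.1.erase v).filter (w ≤ ·)) =
      ∑ w ∈ I.1, (∑ v ∈ I.1.filter (· < w), (-1) ^ (I.1.filter (· < v)).card *
        φ.evalOn ((I.1.filter (· ≤ w)).erase v) * ψ.evalOn (I.1.filter (w ≤ ·)) +
      ∑ v ∈ I.1.filter (w < ·), (-1) ^ (I.1.filter (· < v)).card *
        φ.evalOn (I.1.filter (· ≤ w)) * ψ.evalOn ((I.1.filter (w ≤ ·)).erase v)) := by
    rw [Finset.sum_comm' (t' := I.1) (s' := fun w => I.1.erase w)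
      (by intro v w; simp only [Finset.mem_erase]; tauto)]
    refine Finset.sum_congr rfl fun w hw => ?_
    have hd : Disjoint (I.1.filter (· < w)) (I.1.filter (w < ·)) := by
      rw [Finset.disjoint_filter]
      exact fun v _ h h' => (h.trans h').false
    have hu : I.1.erase w = I.1.filter (· < w) ∪ I.1.filter (w < ·) := by
      ext v
      simp only [Finset.mem_erase, Finset.mem_union, Finset.mem_filter, ne_eq]
      rcases lt_trichotomy v w with h | h | h
      · simp [h, h.ne, h.not_gt]
      · simp [h]
      · simp [h, h.ne', h.not_gt]
    rw [hu, Finset.sum_union hd]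
    congr 1
    · refine Finset.sum_congr rfl fun v hv => ?_
      simp only [Finset.mem_filter] at hv
      rw [Finset.filter_erase, Finset.filter_erase,
        Finset.erase_eq_of_notMem (s := I.1.filter (w ≤ ·)) (by simp [hv.2])]
    · refine Finset.sum_congr rfl fun v hv => ?_
      simp only [Finset.mem_filter] at hv
      rw [Finset.filter_erase, Finset.filter_erase,
        Finset.erase_eq_of_notMem (s := I.1.filter (· ≤ w)) (by simp [hv.2])]
  -- On the right-hand side `v = w` also occurs, once in each product. `hR1` and `hR2` split off
  -- these extra terms.
  have hR1 : ∀ w ∈ I.1, ∑ v ∈ I.1.filter (· ≤ w),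
      (-1) ^ ((I.1.filter (· ≤ w)).filter (· < v)).card *
        φ.evalOn ((I.1.filter (· ≤ w)).erase v) * ψ.evalOn (I.1.filter (w ≤ ·)) =
      ∑ v ∈ I.1.filter (· < w), (-1) ^ (I.1.filter (· < v)).card *
        φ.evalOn ((I.1.filter (· ≤ w)).erase v) * ψ.evalOn (I.1.filter (w ≤ ·)) +
      (-1) ^ (I.1.filter (· < w)).card *
        (φ.evalOn (I.1.filter (· < w)) * ψ.evalOn (I.1 \ I.1.filter (· < w))) := by
    intro w hw
    have h0 : I.1.filter (· ≤ w) = insert w (I.1.filter (· < w)) := by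
      ext v; simp only [Finset.mem_filter, Finset.mem_insert]; grind
    have h1 : ∀ v ≤ w, (I.1.filter (· ≤ w)).filter (· < v) = I.1.filter (· < v) := by
      intro v hv; ext z; simp only [Finset.mem_filter]; grind
    have h2 : (I.1.filter (· ≤ w)).erase w = I.1.filter (· < w) := by
      rw [h0, Finset.erase_insert (by simp)]
    have h3 : I.1.filter (w ≤ ·) = I.1 \ I.1.filter (· < w) := by
      ext z; simp only [Finset.mem_filter, Finset.mem_sdiff]; grind
    conv_lhs => rw [Finset.sum_congr h0 (fun _ _ => rfl)]
    rw [Finset.sum_insert (by simp), h2, h1 w le_rfl, add_comm, mul_assoc, ← h3]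
    refine congrArg (· + _) (Finset.sum_congr rfl fun v hv => ?_)
    rw [h1 v (Finset.mem_filter.1 hv).2.le]
  have hR2 : ∀ w ∈ I.1, ∑ v ∈ I.1.filter (w ≤ ·), (-1) ^ (I.1.filter (· < w)).card *
      φ.evalOn (I.1.filter (· ≤ w)) * (-1) ^ ((I.1.filter (w ≤ ·)).filter (· < v)).card *
        ψ.evalOn ((I.1.filter (w ≤ ·)).erase v) =
      ∑ v ∈ I.1.filter (w < ·), (-1) ^ (I.1.filter (· < v)).card *
        φ.evalOn (I.1.filter (· ≤ w)) * ψ.evalOn ((I.1.filter (w ≤ ·)).erase v) +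
      (-1) ^ (I.1.filter (· < w)).card *
        (φ.evalOn (I.1.filter (· ≤ w)) * ψ.evalOn (I.1 \ I.1.filter (· ≤ w))) := by
    intro w hw
    have h0 : I.1.filter (w ≤ ·) = insert w (I.1.filter (w < ·)) := by
      ext v; simp only [Finset.mem_filter, Finset.mem_insert]; grind
    have h1 : ∀ v, w ≤ v → (I.1.filter (· < v)).card =
        (I.1.filter (· < w)).card + ((I.1.filter (w ≤ ·)).filter (· < v)).card := by
      intro v hv
      rw [← Finset.card_union_of_disjoint]
      · congr 1
        ext z; simp only [Finset.mem_filter, Finset.mem_union]; grind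
      · rw [Finset.disjoint_left]
        intro z; simp only [Finset.mem_filter]; grind
    have h2 : (I.1.filter (w ≤ ·)).erase w = I.1 \ I.1.filter (· ≤ w) := by
      ext z; simp only [Finset.mem_filter, Finset.mem_erase, Finset.mem_sdiff]; grind
    have h3 : (I.1.filter (w ≤ ·)).filter (· < w) = ∅ := by
      ext z; simp only [Finset.mem_filter, Finset.notMem_empty]; grind
    conv_lhs => rw [Finset.sum_congr h0 (fun _ _ => rfl)]
    rw [Finset.sum_insert (by simp), h2, h3, add_comm, Finset.card_empty, pow_zero, mul_one,
      mul_assoc]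
    refine congrArg (· + _) (Finset.sum_congr rfl fun v hv => ?_)
    rw [h1 v (Finset.mem_filter.1 hv).2.le, pow_add]
    ring
  -- The extra terms telescope. Both boundary terms vanish because `evalOn` is zero on the empty
  -- set.
  have ht := sum_initial_segments (fun t => φ.evalOn t * ψ.evalOn (I.1 \ t)) I.1
  simp only [evalOn_empty, zero_mul, Finset.sdiff_self, mul_zero, sub_zero, mul_add,
    Finset.sum_add_distrib] at ht
  rw [hL, Finset.sum_congr rfl hR1, Finset.sum_congr rfl hR2, Finset.sum_add_distrib,
    Finset.sum_add_distrib, Finset.sum_add_distrib]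
  linear_combination -ht

end Cochain

theorem Cochain.prod_ofFn_mem_degreePart {K : Type u} [Field K] {V : Type} [LinearOrder V]
    (l : ℕ) (c : Fin l → Cochain K V) (q : Fin l → ℤ)
    (hc : ∀ j, c j ∈ Cochain.degreePart K V (q j)) :
    (List.ofFn c).prod ∈ Cochain.degreePart K V (∑ j, q j) := by
  induction l with
  | zero => simpa using Cochain.one_mem_degreePart
  | succ l ih =>
    rw [List.ofFn_succ, List.prod_cons, Fin.sum_univ_succ]
    exact Cochain.mul_mem_degreePart (hc 0) (ih _ _ fun j => hc j.succ)

/-! ### Signs, degrees and filtration on `A ⊗ N^•`. -/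

namespace CompleteShiftedAInfinity

variable {K : Type u} [Field K] {A : Type v} [AddCommGroup A] [Module K A]
  (S : CompleteShiftedAInfinity K A)

theorem koszul_koszul (m m' : ℤ) (a : A) :
    S.koszul m (S.koszul m' a) = S.koszul (m + m') a := by
  induction a using DirectSum.Decomposition.inductionOn S.deg with
  | zero => simp
  | @homogeneous p a =>
    rw [S.koszul_of_mem m' a.2, S.koszul_of_mem (m + m') a.2, Units.smul_def, map_zsmul,
      S.koszul_of_mem m a.2, add_mul, Int.negOnePow_add]
    simp only [Units.smul_def, Units.val_mul, smul_smul, mul_comm]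
  | add x y hx hy => simp only [map_add, hx, hy]

theorem koszul_mem_deg (m : ℤ) {p : ℤ} {a : A} (ha : a ∈ S.deg p) : S.koszul m a ∈ S.deg p := by
  rw [S.koszul_of_mem m ha, Units.smul_def]
  exact zsmul_mem ha _

/-- This needs the filtration to consist of graded subspaces, since `koszul` changes the sign of
each homogeneous component separately. -/
theorem koszul_mem_fil (m : ℤ) {k : ℕ} {a : A} (ha : a ∈ S.fil k) : S.koszul m a ∈ S.fil k := by
  classical
  rw [← DirectSum.sum_support_decompose S.deg a, map_sum]
  refine sum_mem fun p _ => ?_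
  rw [S.koszul_of_mem m (DirectSum.decompose S.deg a p).2, Units.smul_def]
  exact zsmul_mem (S.fil_homogeneous k a ha p) _

theorem koszul_zero (a : A) : S.koszul 0 a = a := by
  induction a using DirectSum.Decomposition.inductionOn S.deg with
  | zero => simp
  | @homogeneous p a => rw [S.koszul_of_mem 0 a.2]; simp
  | add x y hx hy => simp only [map_add, hx, hy]

theorem koszul_one_koszul_one (a : A) : S.koszul 1 (S.koszul 1 a) = a := by
  induction a using DirectSum.Decomposition.inductionOn S.deg with
  | zero => simp
  | @homogeneous p a =>
    rw [S.koszul_of_mem 1 a.2, Units.smul_def, map_zsmul, S.koszul_of_mem 1 a.2, ← Units.smul_def,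
      smul_smul, ← Int.negOnePow_add, Int.negOnePow_even _ ⟨_, rfl⟩, one_smul]
  | add x y hx hy => simp only [map_add, hx, hy]

theorem fil_zero : S.fil 0 = ⊤ := top_le_iff.1 (S.fil_one ▸ S.fil_antitone zero_le_one)

theorem eq_zero_of_forall_mem_fil {a : A} (h : ∀ k, a ∈ S.fil k) : a = 0 := by
  have : a ∈ ⨅ k, S.fil k := (Submodule.mem_iInf _).2 h
  rwa [S.fil_separated] at this

variable {V : Type} [LinearOrder V]

theorem coeff_tmul_basisCochain (I J : Face V) (a : A) :
    coeff K A I (a ⊗ₜ[K] (Cochain.basisCochain J : Cochain K V)) = if I = J then a else 0 := by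
  rw [coeff_tmul, Cochain.basisCochain]
  by_cases h : I = J <;> simp [h]

theorem ext_coeff [Fintype V] {x y : A ⊗[K] Cochain K V}
    (h : ∀ I, coeff K A I x = coeff K A I y) : x = y := by
  rw [sum_coeff x, sum_coeff y]
  exact Finset.sum_congr rfl fun I _ => by rw [h]

theorem tmul_mem_tensorDeg {p q m : ℤ} {a : A} {φ : Cochain K V} (ha : a ∈ S.deg p)
    (hφ : φ ∈ Cochain.degreePart K V q) (h : p + q = m) : a ⊗ₜ[K] φ ∈ S.tensorDeg V m := by
  obtain rfl : q = m - p := by omega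
  exact Submodule.mem_iSup_of_mem p (Submodule.apply_mem_map₂ _ ha hφ)

theorem tmul_mem_tensorFil {k : ℕ} {a : A} (φ : Cochain K V) (ha : a ∈ S.fil k) :
    a ⊗ₜ[K] φ ∈ S.tensorFil V k :=
  Submodule.apply_mem_map₂ _ ha Submodule.mem_top

theorem coeff_mem_deg {m : ℤ} {x : A ⊗[K] Cochain K V} (hx : x ∈ S.tensorDeg V m) (I : Face V) :
    coeff K A I x ∈ S.deg (m - I.dim) := by
  suffices h : S.tensorDeg V m ≤ (S.deg (m - I.dim)).comap (coeff K A I) from h hx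
  refine iSup_le fun p => Submodule.map₂_le.2 fun a ha φ hφ => ?_
  rw [Submodule.mem_comap, TensorProduct.mk_apply, coeff_tmul]
  by_cases h : I.dim = m - p
  · rw [h, sub_sub_cancel]
    exact Submodule.smul_mem _ _ ha
  · rw [hφ I h, zero_smul]
    exact zero_mem _

theorem coeff_mem_fil {k : ℕ} {x : A ⊗[K] Cochain K V} (hx : x ∈ S.tensorFil V k) (I : Face V) :
    coeff K A I x ∈ S.fil k := by
  suffices h : S.tensorFil V k ≤ (S.fil k).comap (coeff K A I) from h hx
  refine Submodule.map₂_le.2 fun a ha φ hφ => ?_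
  rw [Submodule.mem_comap, TensorProduct.mk_apply, coeff_tmul]
  exact Submodule.smul_mem _ _ ha

theorem mem_tensorFil_iff [Fintype V] {k : ℕ} {x : A ⊗[K] Cochain K V} :
    x ∈ S.tensorFil V k ↔ ∀ I, coeff K A I x ∈ S.fil k := by
  refine ⟨fun h => S.coeff_mem_fil h, fun h => ?_⟩
  rw [sum_coeff x]
  exact sum_mem fun I _ => S.tmul_mem_tensorFil _ (h I)

theorem tensorFil_antitone : Antitone (S.tensorFil V) := fun _ _ h =>
  Submodule.map₂_le_map₂_left (S.fil_antitone h)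

theorem tensorFil_one [Fintype V] : S.tensorFil V 1 = ⊤ := by
  refine top_le_iff.1 fun x _ => S.mem_tensorFil_iff.2 fun I => ?_
  simp [S.fil_one]

theorem tensorOp_mem_tensorFil [Fintype V] (l : ℕ) (k : Fin l → ℕ)
    (x : Fin l → A ⊗[K] Cochain K V) (hx : ∀ j, x j ∈ S.tensorFil V (k j)) :
    S.tensorOp V l x ∈ S.tensorFil V (∑ j, k j) := by
  rw [tensorOp_apply]
  exact sum_mem fun I _ => S.tmul_mem_tensorFil _ (S.Q_fil l k _ fun j =>
    S.koszul_mem_fil _ (S.coeff_mem_fil (hx j) _))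

theorem tensorD_mem_tensorFil {k : ℕ} {x : A ⊗[K] Cochain K V} (hx : x ∈ S.tensorFil V k) :
    S.tensorD V x ∈ S.tensorFil V k := by
  suffices h : S.tensorFil V k ≤ (S.tensorFil V k).comap (S.tensorD V) from h hx
  exact Submodule.map₂_le.2 fun a ha φ _ => S.tmul_mem_tensorFil _ (S.koszul_mem_fil 1 ha)

theorem tensorQ_one_apply [Fintype V] (x : Fin 1 → A ⊗[K] Cochain K V) :
    S.tensorQ V 1 x = S.tensorOp V 1 x + S.tensorD V (x 0) := rfl

theorem tensorQ_mem_tensorFil [Fintype V] (l : ℕ) (k : Fin l → ℕ)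
    (x : Fin l → A ⊗[K] Cochain K V) (hx : ∀ j, x j ∈ S.tensorFil V (k j)) :
    S.tensorQ V l x ∈ S.tensorFil V (∑ j, k j) := by
  match l with
  | 0 => exact S.tensorOp_mem_tensorFil 0 k x hx
  | 1 =>
    rw [tensorQ_one_apply]
    refine add_mem (S.tensorOp_mem_tensorFil 1 k x hx) ?_
    simpa using S.tensorD_mem_tensorFil (hx 0)
  | (l + 2) => exact S.tensorOp_mem_tensorFil (l + 2) k x hx

theorem tensorOp_mem_tensorDeg [Fintype V] (l : ℕ) (e : Fin l → ℤ)
    (x : Fin l → A ⊗[K] Cochain K V) (hx : ∀ j, x j ∈ S.tensorDeg V (e j)) :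
    S.tensorOp V l x ∈ S.tensorDeg V (∑ j, e j + 1) := by
  rw [tensorOp_apply]
  refine sum_mem fun I _ => S.tmul_mem_tensorDeg (S.Q_deg l (fun j => e j - (I j).dim) _ fun j =>
    S.koszul_mem_deg _ (S.coeff_mem_deg (hx j) _))
    (Cochain.prod_ofFn_mem_degreePart l _ (fun j => (I j).dim) fun j => basisCochain_mem _) ?_
  rw [Finset.sum_sub_distrib]
  ring

theorem tensorD_mem_tensorDeg {m : ℤ} {x : A ⊗[K] Cochain K V} (hx : x ∈ S.tensorDeg V m) :
    S.tensorD V x ∈ S.tensorDeg V (m + 1) := by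
  suffices h : S.tensorDeg V m ≤ (S.tensorDeg V (m + 1)).comap (S.tensorD V) from h hx
  exact iSup_le fun p => Submodule.map₂_le.2 fun a ha φ hφ => S.tmul_mem_tensorDeg
    (S.koszul_mem_deg 1 ha) (Cochain.d_mem_degreePart hφ) (by ring)

theorem tensorQ_mem_tensorDeg [Fintype V] (l : ℕ) (e : Fin l → ℤ)
    (x : Fin l → A ⊗[K] Cochain K V) (hx : ∀ j, x j ∈ S.tensorDeg V (e j)) :
    S.tensorQ V l x ∈ S.tensorDeg V (∑ j, e j + 1) := by
  match l with
  | 0 => exact S.tensorOp_mem_tensorDeg 0 e x hx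
  | 1 =>
    rw [tensorQ_one_apply]
    refine add_mem (S.tensorOp_mem_tensorDeg 1 e x hx) ?_
    simpa using S.tensorD_mem_tensorDeg (hx 0)
  | (l + 2) => exact S.tensorOp_mem_tensorDeg (l + 2) e x hx

theorem coeff_tensorD (I : Face V) (x : A ⊗[K] Cochain K V) :
    coeff K A I (S.tensorD V x) = ∑ v ∈ I.1, (-1 : K) ^ (I.1.filter (· < v)).card •
      S.koszul 1 (if h : (I.1.erase v).Nonempty then coeff K A ⟨_, h⟩ x else 0) := by
  induction x with
  | zero => simp
  | add x y hx hy =>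
    simp only [map_add, hx, hy, ← Finset.sum_add_distrib, ← smul_add]
    refine Finset.sum_congr rfl fun v _ => ?_
    split_ifs <;> simp
  | tmul a φ =>
    rw [tensorD, TensorProduct.map_tmul, coeff_tmul, Cochain.d_apply, Finset.sum_smul]
    refine Finset.sum_congr rfl fun v _ => ?_
    rw [mul_smul, Cochain.evalOn]
    split_ifs <;> simp

theorem facet_ne {J : Face V} {v : V} (hv : v ∈ J.1) (hne : (J.1.erase v).Nonempty) :
    J ≠ (⟨J.1.erase v, hne⟩ : Face V) :=
  fun h => Finset.erase_ne_self.2 hv (congrArg Subtype.val h).symm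

/-- The coboundary on `J` is a signed sum over the facets of `J`, and only the distinguished facet
may carry a large coefficient. This isolates that coefficient, both for solving the Maurer-Cartan
equation and for exploiting the Bianchi identity. -/
theorem coeff_tensorD_sub_mem_fil {J : Face V} {v : V} (hv : v ∈ J.1) (hne : (J.1.erase v).Nonempty) {k : ℕ}
    {x : A ⊗[K] Cochain K V}
    (h : ∀ I : Face V, I ≠ ⟨J.1.erase v, hne⟩ → coeff K A I x ∈ S.fil k) :
    coeff K A J (S.tensorD V x) - (-1 : K) ^ (J.1.filter (· < v)).card •
      S.koszul 1 (coeff K A ⟨J.1.erase v, hne⟩ x) ∈ S.fil k := by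
  rw [coeff_tensorD, ← Finset.sum_erase_add _ _ hv, dif_pos hne, add_sub_cancel_right]
  refine sum_mem fun w hw => Submodule.smul_mem _ _ (S.koszul_mem_fil _ ?_)
  split_ifs with hw'
  · refine h _ fun he => ?_
    have he' : J.1.erase w = J.1.erase v := congrArg Subtype.val he
    have : w ∈ J.1.erase w := by rw [he']; exact hw
    simp at this
  · exact zero_mem _

theorem mem_fil_of_sign_smul_koszul {n k : ℕ} {a : A}
    (h : (-1 : K) ^ n • S.koszul 1 a ∈ S.fil k) : a ∈ S.fil k := by
  have := S.koszul_mem_fil 1 (Submodule.smul_mem _ ((-1 : K) ^ n) h)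
  rwa [smul_smul, ← mul_pow, neg_one_mul, neg_neg, one_pow, one_smul, koszul_one_koszul_one] at this

end CompleteShiftedAInfinity

/-! ### Multilinear operations applied to sequences, and insertion of one operation into another. -/

section Insertion

variable {K : Type u} [Field K] {M : Type v} [AddCommGroup M] [Module K M]

/-- The value of the operation of arity `n` on the first `n` terms of a sequence. -/
def seqOp (P : ∀ n : ℕ, MultilinearMap K (fun _ : Fin n => M) M) (n : ℕ) (x : ℕ → M) : M :=
  P n fun j => x j

/-- The sequence `x_0, …, x_{a-1}, R_b(x_a, …, x_{a+b-1}), x_{a+b}, …`. -/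
def insertSeq (R : ∀ n : ℕ, MultilinearMap K (fun _ : Fin n => M) M) (a b : ℕ) (x : ℕ → M) :
    ℕ → M :=
  fun j => if j < a then x j else if j = a then seqOp R b (fun i => x (a + i)) else x (j - 1 + b)

variable (P P' R R' : ∀ n : ℕ, MultilinearMap K (fun _ : Fin n => M) M)

theorem seqOp_congr {n : ℕ} {x y : ℕ → M} (h : ∀ j < n, x j = y j) : seqOp P n x = seqOp P n y :=
  congrArg (P n) (funext fun j => h j j.2)

theorem update_val_eq {M : Type*} {n s : ℕ} (hs : s < n) (x : ℕ → M) (y : M) :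
    (fun j : Fin n => Function.update x s y j) = Function.update (fun j : Fin n => x j) ⟨s, hs⟩ y := by
  funext j
  by_cases h : j = ⟨s, hs⟩
  · subst h; simp
  · rw [Function.update_of_ne h, Function.update_of_ne fun h' => h (Fin.ext h')]

theorem seqOp_update_add {n s : ℕ} (hs : s < n) (x : ℕ → M) (y z : M) :
    seqOp P n (Function.update x s (y + z)) =
      seqOp P n (Function.update x s y) + seqOp P n (Function.update x s z) := by
  simp only [seqOp, update_val_eq hs, MultilinearMap.map_update_add]

theorem seqOp_update_smul {n s : ℕ} (hs : s < n) (x : ℕ → M) (c : K) (y : M) :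
    seqOp P n (Function.update x s (c • y)) = c • seqOp P n (Function.update x s y) := by
  simp only [seqOp, update_val_eq hs, MultilinearMap.map_update_smul]

theorem insertSeq_update_of_lt {a b s : ℕ} (hs : s < a) (x : ℕ → M) (y : M) :
    insertSeq R a b (Function.update x s y) = Function.update (insertSeq R a b x) s y := by
  funext j
  by_cases hj : j = s
  · subst hj; simp [insertSeq, hs]
  · rw [Function.update_of_ne hj]
    simp only [insertSeq]
    split_ifs with h1 h2
    · rw [Function.update_of_ne hj]
    · exact seqOp_congr R fun i _ => Function.update_of_ne (by omega) _ _
    · rw [Function.update_of_ne (by omega)]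

theorem insertSeq_update_of_mem {a b s : ℕ} (hs : a ≤ s) (hs' : s < a + b) (x : ℕ → M) (y : M) :
    insertSeq R a b (Function.update x s y) = Function.update (insertSeq R a b x) a
      (seqOp R b (Function.update (fun i => x (a + i)) (s - a) y)) := by
  funext j
  by_cases hj : j = a
  · subst hj
    simp only [insertSeq, lt_irrefl, if_false, if_true, Function.update_self]
    refine seqOp_congr R fun i _ => ?_
    by_cases hi : i = s - j
    · subst hi; rw [Function.update_self, show j + (s - j) = s by omega, Function.update_self]
    · rw [Function.update_of_ne hi, Function.update_of_ne (by omega)]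
  · rw [Function.update_of_ne hj]
    simp only [insertSeq, hj, if_false]
    split_ifs with h1
    · rw [Function.update_of_ne (by omega)]
    · rw [Function.update_of_ne (by omega)]

theorem insertSeq_update_of_ge {a b s : ℕ} (hs : a + b ≤ s) (x : ℕ → M) (y : M) :
    insertSeq R a b (Function.update x s y) =
      Function.update (insertSeq R a b x) (s - b + 1) y := by
  funext j
  by_cases hj : j = s - b + 1
  · subst hj
    rw [Function.update_self, insertSeq, if_neg (by omega), if_neg (by omega),
      show s - b + 1 - 1 + b = s by omega, Function.update_self]
  · rw [Function.update_of_ne hj]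
    simp only [insertSeq]
    split_ifs with h1 h2
    · rw [Function.update_of_ne (by omega)]
    · exact seqOp_congr R fun i _ => Function.update_of_ne (by omega) _ _
    · rw [Function.update_of_ne (by omega)]

/-- Slot `s` lies before, inside or after the inserted block. Accordingly it becomes slot `s`, slot
`a` or slot `s - b + 1` of the outer operation. -/
theorem seqOp_insertSeq_update_add {a b c s : ℕ} (hs : s < a + b + c) (x : ℕ → M) (y z : M) :
    seqOp P (a + 1 + c) (insertSeq R a b (Function.update x s (y + z))) =
      seqOp P (a + 1 + c) (insertSeq R a b (Function.update x s y)) +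
      seqOp P (a + 1 + c) (insertSeq R a b (Function.update x s z)) := by
  rcases lt_or_ge s a with h | h
  · simp only [insertSeq_update_of_lt R h]
    exact seqOp_update_add P (by omega) _ _ _
  rcases lt_or_ge s (a + b) with h' | h'
  · simp only [insertSeq_update_of_mem R h h']
    rw [seqOp_update_add R (by omega), seqOp_update_add P (by omega)]
  · simp only [insertSeq_update_of_ge R h']
    exact seqOp_update_add P (by omega) _ _ _

theorem seqOp_insertSeq_congr {a b c : ℕ} {x y : ℕ → M} (h : ∀ j < a + b + c, x j = y j) :
    seqOp P (a + 1 + c) (insertSeq R a b x) = seqOp P (a + 1 + c) (insertSeq R a b y) := by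
  refine seqOp_congr P fun j hj => ?_
  simp only [insertSeq]
  split_ifs with h1 h2
  · exact h j (by omega)
  · exact seqOp_congr R fun i hi => h _ (by omega)
  · exact h _ (by omega)

theorem insertSeq_eq_update (a b : ℕ) (x : ℕ → M) :
    insertSeq R a b x =
      Function.update (insertSeq R a b x) a (seqOp R b (fun i => x (a + i))) := by
  conv_lhs => rw [← Function.update_eq_self a (insertSeq R a b x)]
  simp [insertSeq]

/-- Composition is biadditive in the two families. This later splits the relations for `tensorQ`
into four sums, with or without the coboundary on the outside and on the inside. -/
theorem seqOp_insertSeq_add_add (a b c : ℕ) (x : ℕ → M) :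
    seqOp (fun n => P n + P' n) (a + 1 + c) (insertSeq (fun n => R n + R' n) a b x) =
      (seqOp P (a + 1 + c) (insertSeq R a b x) + seqOp P (a + 1 + c) (insertSeq R' a b x)) +
      (seqOp P' (a + 1 + c) (insertSeq R a b x) + seqOp P' (a + 1 + c) (insertSeq R' a b x)) := by
  have h : insertSeq (fun n => R n + R' n) a b x = Function.update (insertSeq R a b x) a
      (seqOp R b (fun i => x (a + i)) + seqOp R' b (fun i => x (a + i))) := by
    funext j
    by_cases hj : j = a
    · subst hj; simp [insertSeq, seqOp]
    · rw [Function.update_of_ne hj]; simp [insertSeq, hj]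
  have h' : insertSeq R' a b x = Function.update (insertSeq R a b x) a
      (seqOp R' b (fun i => x (a + i))) := by
    funext j
    by_cases hj : j = a
    · subst hj; simp [insertSeq]
    · rw [Function.update_of_ne hj]; simp [insertSeq, hj]
  have hadd : ∀ y, seqOp (fun n => P n + P' n) (a + 1 + c) y =
      seqOp P (a + 1 + c) y + seqOp P' (a + 1 + c) y := fun y => rfl
  rw [hadd, h, seqOp_update_add P (by omega), seqOp_update_add P' (by omega), ← h',
    ← insertSeq_eq_update]

/-- A function of `n` arguments that is additive in each of them vanishes on the additive monoid
spanned by `E` if it vanishes on `E`. -/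
theorem eq_zero_of_forall_mem_closure {N : Type*} [AddCommGroup N] (F : (ℕ → M) → N) (n : ℕ)
    (E : Set M) (h0 : 0 ∈ E)
    (hadd : ∀ x, ∀ s < n, ∀ y z, F (Function.update x s (y + z)) =
      F (Function.update x s y) + F (Function.update x s z))
    (hcongr : ∀ x y, (∀ j < n, x j = y j) → F x = F y)
    (hE : ∀ x, (∀ j, x j ∈ E) → F x = 0) (x : ℕ → M)
    (hx : ∀ j < n, x j ∈ AddSubmonoid.closure E) : F x = 0 := by
  -- Induction on the number `m` of leading entries that are allowed to leave `E` for its span.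
  have key : ∀ m ≤ n, ∀ x : ℕ → M, (∀ j < m, x j ∈ AddSubmonoid.closure E) →
      (∀ j, m ≤ j → x j ∈ E) → F x = 0 := by
    intro m
    induction m with
    | zero => exact fun _ x _ h => hE x fun j => h j (Nat.zero_le j)
    | succ m ih =>
      intro hm x h1 h2
      have hE' : ∀ y ∈ E, F (Function.update x m y) = 0 := by
        intro y hy
        refine ih (by omega) _ (fun j hj => ?_) fun j hj => ?_
        · rw [Function.update_of_ne (by omega)]
          exact h1 j (by omega)
        · by_cases hjm : j = m
          · subst hjm; simpa using hy
          · rw [Function.update_of_ne hjm]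
            exact h2 j (by omega)
      have : ∀ y ∈ AddSubmonoid.closure E, F (Function.update x m y) = 0 := by
        intro y hy
        induction hy using AddSubmonoid.closure_induction with
        | mem y hy => exact hE' y hy
        | zero => exact hE' 0 h0
        | add y z _ _ hy hz => rw [hadd x m (by omega), hy, hz, add_zero]
      simpa using this (x m) (h1 m (by omega))
  -- The entries beyond `n` are irrelevant to `F`, but `hE` requires every entry to be in `E`; they
  -- are set to `0`.
  rw [hcongr x (fun j => if j < n then x j else 0) fun j hj => by simp [hj]]
  refine key n le_rfl _ (fun j hj => ?_) fun j hj => ?_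
  · simpa [hj] using hx j hj
  · simpa [hj.not_gt] using h0

end Insertion

theorem sum_Iio_fin {N : Type*} [AddCommMonoid N] {l : ℕ} (q : ℕ → N) (j : Fin l) :
    ∑ i ∈ Finset.Iio j, q i = ∑ i ∈ Finset.range j, q i := by
  have h := Finset.sum_map (Finset.Iio j) Fin.valEmbedding q
  rw [Fin.map_valEmbedding_Iio] at h
  rw [← Nat.Iio_eq_range, h]
  rfl

theorem ofFn_val_eq_map_range {α : Type*} (l : ℕ) (f : ℕ → α) :
    List.ofFn (fun j : Fin l => f j) = (List.range l).map f := by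
  apply List.ext_getElem <;> simp

theorem prod_range_add {α : Type*} [Monoid α] (f : ℕ → α) (a b : ℕ) :
    ((List.range (a + b)).map f).prod =
      ((List.range a).map f).prod * ((List.range b).map fun i => f (a + i)).prod := by
  rw [List.range_add, List.map_append, List.prod_append, List.map_map]
  rfl

theorem prod_range_succ {α : Type*} [Monoid α] (f : ℕ → α) (a : ℕ) :
    ((List.range (a + 1)).map f).prod = ((List.range a).map f).prod * f a := by
  rw [prod_range_add]; simp

theorem prod_range_congr {α : Type*} [Monoid α] {f g : ℕ → α} {a : ℕ} (h : ∀ i < a, f i = g i) :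
    ((List.range a).map f).prod = ((List.range a).map g).prod := by
  rw [List.map_congr_left fun i hi => h i (List.mem_range.1 hi)]

/-! ### The A_∞-relations of `A ⊗ N^•` on elements of degree zero. -/

namespace CompleteShiftedAInfinity

variable {K : Type u} [Field K] {A : Type v} [AddCommGroup A] [Module K A]
  (S : CompleteShiftedAInfinity K A)

theorem negOnePow_smul_eq {M : Type*} [AddCommGroup M] [Module K M] (n : ℤ) (x : M) :
    n.negOnePow • x = (((n.negOnePow : ℤˣ) : ℤ) : K) • x := by
  rw [Units.smul_def, Int.cast_smul_eq_zsmul]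

theorem prod_negOnePow (l : ℕ) (e : Fin l → ℤ) :
    ∏ i, ((((e i).negOnePow : ℤˣ) : ℤ) : K) = (((∑ i, e i).negOnePow : ℤˣ) : ℤ) := by
  induction l with
  | zero => simp
  | succ l ih => rw [Fin.prod_univ_succ, ih, Fin.sum_univ_succ, Int.negOnePow_add]; push_cast; rfl

/-- The operations `Q_l` evaluated on arguments rescaled by signs. -/
theorem Q_negOnePow_smul (l : ℕ) (e : Fin l → ℤ) (x : Fin l → A) :
    S.Q l (fun i => (e i).negOnePow • x i) = (∑ i, e i).negOnePow • S.Q l x := by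
  simp only [negOnePow_smul_eq (K := K)]
  rw [MultilinearMap.map_smul_univ, prod_negOnePow]

/-- The operations `Q_l` have degree `1`, hence commute with `a ↦ (-1)^{m|a|} a` up to `(-1)^m`. -/
theorem Q_koszul (m : ℤ) (l : ℕ) (e : Fin l → ℤ) (x : Fin l → A) (hx : ∀ i, x i ∈ S.deg (e i)) :
    S.koszul m (S.Q l x) = m.negOnePow • S.Q l (fun i => S.koszul m (x i)) := by
  rw [S.koszul_of_mem m (S.Q_deg l e x hx)]
  have : (fun i => S.koszul m (x i)) = fun i => (m * e i).negOnePow • x i :=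
    funext fun i => S.koszul_of_mem m (hx i)
  rw [this, Q_negOnePow_smul, smul_smul, ← Int.negOnePow_add, ← Finset.mul_sum]
  congr 2
  ring

/-- The sequence `(-1)^{(q_0 + … + q_{j-1}) |a_j|} a_j`. -/
def twist (q : ℕ → ℤ) (x : ℕ → A) : ℕ → A :=
  fun j => S.koszul (∑ i ∈ Finset.range j, q i) (x j)

variable {V : Type} [LinearOrder V]

theorem seqOp_tensorOp_tmul [Fintype V] (l : ℕ) (x : ℕ → A) (q : ℕ → ℤ) (c : ℕ → Cochain K V)
    (hc : ∀ j, c j ∈ Cochain.degreePart K V (q j)) :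
    seqOp (S.tensorOp V) l (fun j => x j ⊗ₜ[K] c j) =
      seqOp S.Q l (S.twist q x) ⊗ₜ[K] ((List.range l).map c).prod := by
  rw [seqOp, S.tensorOp_tmul l (fun j => x j) (fun j => q j) (fun j => c j) fun j => hc j,
    ofFn_val_eq_map_range]
  simp only [sum_Iio_fin]
  rfl

theorem prod_range_mem_degreePart (l : ℕ) (q : ℕ → ℤ) (c : ℕ → Cochain K V)
    (hc : ∀ j, c j ∈ Cochain.degreePart K V (q j)) :
    ((List.range l).map c).prod ∈ Cochain.degreePart K V (∑ i ∈ Finset.range l, q i) := by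
  rw [← ofFn_val_eq_map_range, ← Fin.sum_univ_eq_sum_range]
  exact Cochain.prod_ofFn_mem_degreePart l _ (fun j => q j) fun j => hc j

theorem twist_mem_deg {q : ℕ → ℤ} {x : ℕ → A} (hx : ∀ j, x j ∈ S.deg (-q j)) (j : ℕ) :
    S.twist q x j ∈ S.deg (-q j) :=
  S.koszul_mem_deg _ (hx j)

/-- The sequence obtained from `y` by replacing the entries `p, …, p + b - 1` by `w`. -/
def replaceBlock {α : Type*} (p b : ℕ) (w : α) (y : ℕ → α) : ℕ → α :=
  fun j => if j < p then y j else if j = p then w else y (j - 1 + b)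

theorem sum_replaceBlock_of_le {p b j : ℕ} (w : ℤ) (q : ℕ → ℤ) (h : j ≤ p) :
    ∑ i ∈ Finset.range j, replaceBlock p b w q i = ∑ i ∈ Finset.range j, q i :=
  Finset.sum_congr rfl fun i hi => if_pos (by rw [Finset.mem_range] at hi; omega)

/-- Collapsing a block to its total degree leaves later partial sums unchanged up to reindexing, so
the Koszul signs of the arguments after the block do not change. -/
theorem sum_replaceBlock_of_gt {p b j : ℕ} (q : ℕ → ℤ) (h : p < j) :
    ∑ i ∈ Finset.range j, replaceBlock p b (∑ i ∈ Finset.range b, q (p + i)) q i =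
      ∑ i ∈ Finset.range (j - 1 + b), q i := by
  obtain ⟨t, rfl⟩ : ∃ t, j = p + 1 + t := ⟨j - p - 1, by omega⟩
  rw [show p + 1 + t - 1 + b = p + b + t by omega, Finset.sum_range_add _ (p + 1) t,
    Finset.sum_range_add _ (p + b) t, Finset.sum_range_succ, sum_replaceBlock_of_le _ _ le_rfl,
    Finset.sum_range_add _ p b]
  congr 1
  · simp [replaceBlock]
  · refine Finset.sum_congr rfl fun i _ => ?_
    rw [replaceBlock, if_neg (by omega), if_neg (by omega)]
    congr 1
    omega

theorem prod_replaceBlock {p b c : ℕ} (φ : ℕ → Cochain K V) :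
    ((List.range (p + 1 + c)).map
      (replaceBlock p b ((List.range b).map fun i => φ (p + i)).prod φ)).prod =
      ((List.range (p + b + c)).map φ).prod := by
  rw [prod_range_add _ (p + 1) c, prod_range_add _ (p + b) c, prod_range_succ, prod_range_add _ p b]
  congr 1
  · congr 1
    · exact prod_range_congr fun i hi => if_pos hi
    · simp [replaceBlock]
  · refine prod_range_congr fun i _ => ?_
    rw [replaceBlock, if_neg (by omega), if_neg (by omega)]
    congr 1
    omega

/-- The inner block is twisted only by its own cochain degrees. Moving the `p` earlier cochains past
its value twists that value as well; as `Q_b` has degree one, this twist passes to the entries,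
completing their global twist, at the cost of one sign. Because `|x_j| = -q_j`, that sign is the one
in the A_∞-relation of `A`. The cochain factor depends only on `p + b + c`. -/
theorem seqOp_insertSeq_tensorOp [Fintype V] (p b c : ℕ) (x : ℕ → A) (q : ℕ → ℤ) (φ : ℕ → Cochain K V)
    (hx : ∀ j, x j ∈ S.deg (-q j)) (hφ : ∀ j, φ j ∈ Cochain.degreePart K V (q j)) :
    seqOp (S.tensorOp V) (p + 1 + c) (insertSeq (S.tensorOp V) p b (fun j => x j ⊗ₜ[K] φ j)) =
      ((∑ i ∈ Finset.range p, q i).negOnePow •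
        seqOp S.Q (p + 1 + c) (insertSeq S.Q p b (S.twist q x))) ⊗ₜ[K]
        ((List.range (p + b + c)).map φ).prod := by
  have h1 : insertSeq (S.tensorOp V) p b (fun j => x j ⊗ₜ[K] φ j) = fun j =>
      replaceBlock p b (seqOp S.Q b (S.twist (fun i => q (p + i)) fun i => x (p + i))) x j ⊗ₜ[K]
        replaceBlock p b ((List.range b).map fun i => φ (p + i)).prod φ j := by
    funext j
    simp only [insertSeq, replaceBlock]
    split_ifs
    · rfl
    · exact S.seqOp_tensorOp_tmul b _ (fun i => q (p + i)) (fun i => φ (p + i)) fun i => hφ _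
    · rfl
  rw [h1, S.seqOp_tensorOp_tmul (p + 1 + c) _
    (replaceBlock p b (∑ i ∈ Finset.range b, q (p + i)) q), prod_replaceBlock]
  · congr 1
    have h2 : S.twist (replaceBlock p b (∑ i ∈ Finset.range b, q (p + i)) q)
        (replaceBlock p b (seqOp S.Q b (S.twist (fun i => q (p + i)) fun i => x (p + i))) x) =
        Function.update (insertSeq S.Q p b (S.twist q x)) p
          (((((∑ i ∈ Finset.range p, q i).negOnePow : ℤˣ) : ℤ) : K) •
            seqOp S.Q b (fun i => S.twist q x (p + i))) := by
      funext j
      rcases lt_trichotomy j p with hj | hj | hj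
      · rw [Function.update_of_ne hj.ne, twist, sum_replaceBlock_of_le _ _ hj.le]
        simp [replaceBlock, insertSeq, hj, twist]
      · subst hj
        rw [Function.update_self, twist, sum_replaceBlock_of_le _ _ le_rfl, replaceBlock,
          if_neg (lt_irrefl _), if_pos rfl, ← negOnePow_smul_eq, seqOp,
          S.Q_koszul _ b (fun i => -q (j + i)) _ fun i =>
            S.twist_mem_deg (q := fun i => q (j + i)) (fun i => hx _) i]
        congr 2
        funext i
        change S.koszul _ (S.koszul _ _) = S.koszul _ _
        rw [koszul_koszul, Finset.sum_range_add]
      · rw [Function.update_of_ne hj.ne', twist, sum_replaceBlock_of_gt _ hj]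
        simp [replaceBlock, insertSeq, hj.not_gt, hj.ne', twist]
    rw [h2, seqOp_update_smul _ (by omega), negOnePow_smul_eq (K := K), ← insertSeq_eq_update]
  · intro j
    simp only [replaceBlock]
    split_ifs
    · exact hφ j
    · exact prod_range_mem_degreePart b (fun i => q (p + i)) _ fun i => hφ _
    · exact hφ _

/-- The part of the `A_∞`-relation of `A ⊗ N^•` that does not involve the coboundary. -/
theorem sum_insertSeq_tensorOp [Fintype V] (n : ℕ) (x : ℕ → A) (q : ℕ → ℤ) (φ : ℕ → Cochain K V)
    (hx : ∀ j, x j ∈ S.deg (-q j)) (hφ : ∀ j, φ j ∈ Cochain.degreePart K V (q j)) :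
    ∑ abc ∈ Finset.Nat.antidiagonalTuple 3 n, seqOp (S.tensorOp V) (abc 0 + 1 + abc 2)
      (insertSeq (S.tensorOp V) (abc 0) (abc 1) (fun j => x j ⊗ₜ[K] φ j)) = 0 := by
  have h := S.relation n (fun j => -q j) (S.twist q x) fun j => S.twist_mem_deg hx j
  have h' : ∀ abc ∈ Finset.Nat.antidiagonalTuple 3 n, seqOp (S.tensorOp V) (abc 0 + 1 + abc 2)
      (insertSeq (S.tensorOp V) (abc 0) (abc 1) (fun j => x j ⊗ₜ[K] φ j)) =
      ((∑ i ∈ Finset.range (abc 0), -q i).negOnePow •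
        seqOp S.Q (abc 0 + 1 + abc 2) (insertSeq S.Q (abc 0) (abc 1) (S.twist q x))) ⊗ₜ[K]
        ((List.range n).map φ).prod := by
    intro abc habc
    rw [Finset.Nat.mem_antidiagonalTuple, Fin.sum_univ_three] at habc
    rw [S.seqOp_insertSeq_tensorOp _ _ _ x q φ hx hφ, habc, Finset.sum_neg_distrib,
      Int.negOnePow_neg]
  rw [Finset.sum_congr rfl h', ← TensorProduct.sum_tmul]
  -- `seqOp` and `insertSeq` unfold to the very expression used in `relation`.
  exact (congrArg (· ⊗ₜ[K] _) h).trans (TensorProduct.zero_tmul _ _)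

/-- The iterated Leibniz rule. -/
theorem d_prod_range (n : ℕ) (q : ℕ → ℤ) (φ : ℕ → Cochain K V)
    (hφ : ∀ j, φ j ∈ Cochain.degreePart K V (q j)) :
    Cochain.d ((List.range n).map φ).prod = ∑ p ∈ Finset.range n,
      (∑ i ∈ Finset.range p, q i).negOnePow •
        ((List.range n).map (Function.update φ p (Cochain.d (φ p)))).prod := by
  induction n with
  | zero =>
    -- Leibniz applied to `1 * 1` gives `d 1 = d 1 + d 1`, hence `d 1 = 0`.
    have := Cochain.d_mul (Cochain.one_mem_degreePart (K := K) (V := V)) 1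
    simp only [mul_one, one_mul, Int.negOnePow_zero, one_smul, left_eq_add] at this
    simpa using this
  | succ n ih =>
    rw [prod_range_succ, Cochain.d_mul (prod_range_mem_degreePart n q φ hφ), ih,
      Finset.sum_range_succ, Finset.sum_mul]
    congr 1
    · refine Finset.sum_congr rfl fun p hp => ?_
      rw [Finset.mem_range] at hp
      rw [prod_range_succ, Function.update_of_ne hp.ne', Units.smul_def, Units.smul_def,
        smul_mul_assoc]
    · rw [prod_range_succ, Function.update_self]
      congr 2
      exact prod_range_congr fun i hi => (Function.update_of_ne hi.ne _ _).symm

/-- Raising the degree of `φ_p` by one adds a sign `(-1)^{q_j}` to each argument `j > p`, and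
`koszul 1` adds one at `j = p`. The total exponent `∑_{j ≥ p} q_j` is split as the full sum and the
sum below `p`; the latter is the sign of the iterated Leibniz rule. -/
theorem seqOp_update_tensorD [Fintype V] (n p : ℕ) (hp : p < n) (x : ℕ → A) (q : ℕ → ℤ) (φ : ℕ → Cochain K V)
    (hx : ∀ j, x j ∈ S.deg (-q j)) (hφ : ∀ j, φ j ∈ Cochain.degreePart K V (q j)) :
    seqOp (S.tensorOp V) n (Function.update (fun j => x j ⊗ₜ[K] φ j) p
      (S.tensorD V (x p ⊗ₜ[K] φ p))) =
      ((∑ i ∈ Finset.range n, q i).negOnePow • seqOp S.Q n (S.twist q x)) ⊗ₜ[K]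
        ((∑ i ∈ Finset.range p, q i).negOnePow •
        ((List.range n).map (Function.update φ p (Cochain.d (φ p)))).prod) := by
  have h1 : Function.update (fun j => x j ⊗ₜ[K] φ j) p (S.tensorD V (x p ⊗ₜ[K] φ p)) = fun j =>
      Function.update x p (S.koszul 1 (x p)) j ⊗ₜ[K]
        Function.update φ p (Cochain.d (φ p)) j := by
    funext j
    by_cases hj : j = p
    · subst hj; simp [tensorD]
    · simp [Function.update_of_ne hj]
  rw [h1, S.seqOp_tensorOp_tmul n _ (Function.update q p (q p + 1))]
  · have h2 : ∀ j, S.twist (Function.update q p (q p + 1))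
        (Function.update x p (S.koszul 1 (x p))) j =
        (if j < p then (0 : ℤ) else q j).negOnePow • S.twist q x j := by
      intro j
      have hs : j ≤ p → ∑ i ∈ Finset.range j, Function.update q p (q p + 1) i =
          ∑ i ∈ Finset.range j, q i := fun hj => Finset.sum_congr rfl fun i hi =>
        Function.update_of_ne (by rw [Finset.mem_range] at hi; omega) _ _
      have hs' : p < j → ∑ i ∈ Finset.range j, Function.update q p (q p + 1) i =
          ∑ i ∈ Finset.range j, q i + 1 := by
        intro hj
        rw [Finset.sum_update_of_mem (Finset.mem_range.2 hj),
          ← Finset.sum_sdiff (Finset.singleton_subset_iff.2 (Finset.mem_range.2 hj)),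
          Finset.sum_singleton]
        ring
      have hk : S.koszul 1 (S.twist q x j) = (q j).negOnePow • S.twist q x j := by
        rw [S.koszul_of_mem 1 (S.twist_mem_deg hx j), one_mul, Int.negOnePow_neg]
      rcases lt_trichotomy j p with hj | hj | hj
      · rw [twist, hs hj.le, Function.update_of_ne hj.ne, if_pos hj, Int.negOnePow_zero, one_smul]
        rfl
      · subst hj
        rw [if_neg (lt_irrefl _), ← hk, twist, hs le_rfl, Function.update_self, twist,
          koszul_koszul, koszul_koszul, add_comm]
      · rw [if_neg hj.not_gt, ← hk, twist, hs' hj, Function.update_of_ne hj.ne', twist,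
          koszul_koszul, add_comm]
    have h3 : ∑ j : Fin n, (if (j : ℕ) < p then (0 : ℤ) else q j) =
        ∑ i ∈ Finset.range n, q i - ∑ i ∈ Finset.range p, q i := by
      rw [Fin.sum_univ_eq_sum_range (fun j => if j < p then (0 : ℤ) else q j) n]
      obtain ⟨t, rfl⟩ := Nat.exists_eq_add_of_lt hp
      rw [show p + t + 1 = p + (t + 1) by omega, Finset.sum_range_add, Finset.sum_range_add q,
        Finset.sum_eq_zero fun i hi => if_pos (Finset.mem_range.1 hi)]
      simp
    have h4 : seqOp S.Q n (S.twist (Function.update q p (q p + 1))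
        (Function.update x p (S.koszul 1 (x p)))) =
        (∑ i ∈ Finset.range p, q i).negOnePow • (∑ i ∈ Finset.range n, q i).negOnePow •
          seqOp S.Q n (S.twist q x) := by
      rw [seqOp, funext fun j : Fin n => h2 j, Q_negOnePow_smul, h3, Int.negOnePow_sub, smul_smul,
        mul_comm]
      rfl
    rw [h4, Units.smul_def, Units.smul_def (∑ i ∈ Finset.range p, q i).negOnePow (_ : Cochain K V),
      TensorProduct.smul_tmul]
  · intro j
    by_cases hj : j = p
    · subst hj
      simpa using Cochain.d_mem_degreePart (hφ j)
    · rw [Function.update_of_ne hj, Function.update_of_ne hj]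
      exact hφ j

/-- The coboundary of `A ⊗ N^•` is a derivation of the operations `Q_n ⊗ ∪^{(n)}`. -/
theorem tensorD_seqOp_add_sum [Fintype V] (n : ℕ) (x : ℕ → A) (q : ℕ → ℤ) (φ : ℕ → Cochain K V)
    (hx : ∀ j, x j ∈ S.deg (-q j)) (hφ : ∀ j, φ j ∈ Cochain.degreePart K V (q j)) :
    S.tensorD V (seqOp (S.tensorOp V) n (fun j => x j ⊗ₜ[K] φ j)) +
      ∑ p ∈ Finset.range n, seqOp (S.tensorOp V) n (Function.update (fun j => x j ⊗ₜ[K] φ j) p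
        (S.tensorD V (x p ⊗ₜ[K] φ p))) = 0 := by
  rw [Finset.sum_congr rfl fun p hp => S.seqOp_update_tensorD n p (Finset.mem_range.1 hp) x q φ hx hφ,
    ← TensorProduct.tmul_sum, ← d_prod_range n q φ hφ, S.seqOp_tensorOp_tmul n x q φ hφ, tensorD,
    TensorProduct.map_tmul, ← TensorProduct.add_tmul]
  -- The extra minus sign, which makes the two sums cancel, is the degree one of `Q_n`.
  have : S.koszul 1 (seqOp S.Q n (S.twist q x)) =
      -((∑ i ∈ Finset.range n, q i).negOnePow • seqOp S.Q n (S.twist q x)) := by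
    rw [seqOp, S.koszul_of_mem 1 (S.Q_deg n (fun j => -q j) _ fun j => S.twist_mem_deg hx j),
      one_mul, Int.negOnePow_add, Finset.sum_neg_distrib, Int.negOnePow_neg,
      Fin.sum_univ_eq_sum_range, Int.negOnePow_one, mul_neg, mul_one, Units.smul_def,
      Units.smul_def, Units.val_neg, neg_smul]
  rw [this, neg_add_cancel, TensorProduct.zero_tmul]

theorem tensorD_tensorD (x : A ⊗[K] Cochain K V) : S.tensorD V (S.tensorD V x) = 0 := by
  induction x with
  | zero => simp
  | add x y hx hy => simp only [map_add, hx, hy, add_zero]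
  | tmul a φ => simp [tensorD, Cochain.d_d]

end CompleteShiftedAInfinity

namespace CompleteShiftedAInfinity

variable {K : Type u} [Field K] {A : Type v} [AddCommGroup A] [Module K A]
  (S : CompleteShiftedAInfinity K A) {V : Type} [LinearOrder V]

variable (V) in
/-- The coboundary `id ⊗ d`, as a family of operations concentrated in arity `1`. -/
def tensorDOp : ∀ l : ℕ, MultilinearMap K (fun _ : Fin l => A ⊗[K] Cochain K V) (A ⊗[K] Cochain K V)
  | 1 => MultilinearMap.ofSubsingleton K _ _ (0 : Fin 1) (S.tensorD V)
  | _ => 0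

theorem tensorQ_eq_add [Fintype V] (l : ℕ) :
    S.tensorQ V l = S.tensorOp V l + S.tensorDOp V l := by
  match l with
  | 0 => exact (add_zero _).symm
  | 1 => rfl
  | (l + 2) => exact (add_zero _).symm

theorem seqOp_tensorDOp_one (x : ℕ → A ⊗[K] Cochain K V) :
    seqOp (S.tensorDOp V) 1 x = S.tensorD V (x 0) := rfl

theorem seqOp_tensorDOp_of_ne {l : ℕ} (hl : l ≠ 1) (x : ℕ → A ⊗[K] Cochain K V) :
    seqOp (S.tensorDOp V) l x = 0 := by
  match l, hl with
  | 0, _ => rfl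
  | (l + 2), _ => rfl

/-- Only inner arity one contributes, so the triples reduce to `(p, 1, n - 1 - p)`. -/
theorem sum_tensorOp_insertSeq_tensorDOp [Fintype V] (n : ℕ) (x : ℕ → A ⊗[K] Cochain K V) :
    ∑ abc ∈ Finset.Nat.antidiagonalTuple 3 n, seqOp (S.tensorOp V) (abc 0 + 1 + abc 2)
      (insertSeq (S.tensorDOp V) (abc 0) (abc 1) x) =
    ∑ p ∈ Finset.range n,
      seqOp (S.tensorOp V) n (Function.update x p (S.tensorD V (x p))) := by
  symm
  refine Finset.sum_of_injOn (fun p => ![p, 1, n - 1 - p]) ?_ ?_ ?_ ?_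
  · intro p _ p' _ h
    exact congrFun h 0
  · intro p hp
    rw [Finset.mem_coe, Finset.mem_range] at hp
    rw [Finset.mem_coe, Finset.Nat.mem_antidiagonalTuple, Fin.sum_univ_three]
    simp only [Matrix.cons_val]
    omega
  · intro abc habc h
    rw [Finset.Nat.mem_antidiagonalTuple, Fin.sum_univ_three] at habc
    have h1 : abc 1 ≠ 1 := by
      intro h1
      refine h ⟨abc 0, Finset.mem_coe.2 (Finset.mem_range.2 (by omega)), ?_⟩
      funext j
      fin_cases j
      · rfl
      · exact h1.symm
      · simp only [Fin.reduceFinMk, Matrix.cons_val]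
        omega
    rw [insertSeq_eq_update, S.seqOp_tensorDOp_of_ne h1]
    have := seqOp_update_smul (S.tensorOp V) (n := abc 0 + 1 + abc 2) (s := abc 0) (by omega)
      (insertSeq (S.tensorDOp V) (abc 0) (abc 1) x) 0 0
    simpa using this
  · intro p hp
    rw [Finset.mem_range] at hp
    simp only [Matrix.cons_val]
    rw [show p + 1 + (n - 1 - p) = n by omega]
    refine seqOp_congr _ fun j _ => ?_
    rcases lt_trichotomy j p with h | h | h
    · simp [insertSeq, h, h.ne]
    · subst h
      simp [insertSeq, seqOp_tensorDOp_one]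
    · rw [Function.update_of_ne h.ne', insertSeq, if_neg (by omega), if_neg (by omega),
        Nat.sub_add_cancel (by omega)]

/-- Outer arity one forces the triple `(0, n, 0)`. -/
theorem sum_tensorDOp_insertSeq (R : ∀ n : ℕ, MultilinearMap K
      (fun _ : Fin n => A ⊗[K] Cochain K V) (A ⊗[K] Cochain K V))
    (n : ℕ) (x : ℕ → A ⊗[K] Cochain K V) :
    ∑ abc ∈ Finset.Nat.antidiagonalTuple 3 n, seqOp (S.tensorDOp V) (abc 0 + 1 + abc 2)
      (insertSeq R (abc 0) (abc 1) x) = S.tensorD V (seqOp R n x) := by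
  rw [Finset.sum_eq_single_of_mem ![0, n, 0]]
  · simp only [Matrix.cons_val]
    change S.tensorD V (insertSeq R 0 n x 0) = _
    simp [insertSeq]
  · rw [Finset.Nat.mem_antidiagonalTuple, Fin.sum_univ_three]
    simp
  · intro abc habc h
    rw [Finset.Nat.mem_antidiagonalTuple, Fin.sum_univ_three] at habc
    refine S.seqOp_tensorDOp_of_ne (fun h' => h ?_) _
    funext j
    fin_cases j <;> simp only [Fin.reduceFinMk, Matrix.cons_val, Fin.zero_eta, Fin.mk_one] <;> omega

/-- The `A_∞`-relations of `A ⊗ N^•`, evaluated on elements of degree `0`. -/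
theorem sum_insertSeq_tensorQ [Fintype V] (n : ℕ) (x : ℕ → A ⊗[K] Cochain K V)
    (hx : ∀ j, x j ∈ S.tensorDeg V 0) :
    ∑ abc ∈ Finset.Nat.antidiagonalTuple 3 n, seqOp (S.tensorQ V) (abc 0 + 1 + abc 2)
      (insertSeq (S.tensorQ V) (abc 0) (abc 1) x) = 0 := by
  -- By multiadditivity it suffices to treat homogeneous elementary tensors of total degree zero.
  let E : Set (A ⊗[K] Cochain K V) := {y | ∃ (q : ℤ) (a : A) (φ : Cochain K V),
    a ∈ S.deg (-q) ∧ φ ∈ Cochain.degreePart K V q ∧ y = a ⊗ₜ[K] φ}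
  refine eq_zero_of_forall_mem_closure (fun x => ∑ abc ∈ Finset.Nat.antidiagonalTuple 3 n,
    seqOp (S.tensorQ V) (abc 0 + 1 + abc 2) (insertSeq (S.tensorQ V) (abc 0) (abc 1) x)) n E
    ⟨0, 0, 0, zero_mem _, zero_mem _, by simp⟩ ?_ ?_ ?_ x fun j _ => ?_
  · intro x s hs y z
    rw [← Finset.sum_add_distrib]
    refine Finset.sum_congr rfl fun abc habc => ?_
    rw [Finset.Nat.mem_antidiagonalTuple, Fin.sum_univ_three] at habc
    exact seqOp_insertSeq_update_add _ _ (by omega) _ _ _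
  · intro x y h
    refine Finset.sum_congr rfl fun abc habc => ?_
    rw [Finset.Nat.mem_antidiagonalTuple, Fin.sum_univ_three] at habc
    exact seqOp_insertSeq_congr _ _ fun j hj => h j (by omega)
  · intro x hx
    choose q a φ ha hφ h using hx
    obtain rfl : x = fun j => a j ⊗ₜ[K] φ j := funext h
    have hQ : S.tensorQ V = fun l => S.tensorOp V l + S.tensorDOp V l :=
      funext fun l => S.tensorQ_eq_add l
    -- Of the four sums, the one without coboundary vanishes by the relations of `A`, the two mixed
    -- ones cancel by the derivation property, and the last is `d ∘ d`.
    simp only [hQ, seqOp_insertSeq_add_add, Finset.sum_add_distrib]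
    rw [S.sum_insertSeq_tensorOp n a q φ ha hφ, sum_tensorOp_insertSeq_tensorDOp,
      sum_tensorDOp_insertSeq, sum_tensorDOp_insertSeq, zero_add, ← add_assoc,
      add_comm (∑ _ ∈ _, _), S.tensorD_seqOp_add_sum n a q φ ha hφ, zero_add]
    by_cases hn : n = 1
    · subst hn
      rw [seqOp_tensorDOp_one, tensorD_tensorD]
    · rw [S.seqOp_tensorDOp_of_ne hn, map_zero]
  · rw [sum_coeff (x j)]
    refine sum_mem fun I _ => AddSubmonoid.subset_closure ⟨I.dim, _, _, ?_, basisCochain_mem I, rfl⟩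
    have := S.coeff_mem_deg (hx j) I
    rwa [zero_sub] at this

end CompleteShiftedAInfinity

/-! ### Curvature, the Bianchi identity, and the Maurer-Cartan equation at a facet. -/

namespace CompleteShiftedAInfinity

variable {K : Type u} [Field K] {A : Type v} [AddCommGroup A] [Module K A]
  (S : CompleteShiftedAInfinity K A) {V : Type} [LinearOrder V] [Fintype V]

/-- The partial sum of the first `m` terms of the curvature `∑_l NQ_l(x, …, x)`. -/
def curvature (m : ℕ) (x : A ⊗[K] Cochain K V) : A ⊗[K] Cochain K V :=
  ∑ l ∈ Finset.range m, S.tensorQ V l fun _ => x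

theorem curvature_mem_tensorDeg (m : ℕ) {x : A ⊗[K] Cochain K V} (hx : x ∈ S.tensorDeg V 0) :
    S.curvature m x ∈ S.tensorDeg V 1 :=
  sum_mem fun l _ => by simpa using S.tensorQ_mem_tensorDeg l (fun _ => 0) _ fun _ => hx

/-- Every argument counts one because `F¹` is everything. Hence the curvature series always
converges, and modulo `F^k` only its first `k` terms matter. -/
theorem tensorQ_const_mem_tensorFil (l : ℕ) (x : A ⊗[K] Cochain K V) :
    (S.tensorQ V l fun _ => x) ∈ S.tensorFil V l := by
  simpa using S.tensorQ_mem_tensorFil l (fun _ => 1) (fun _ => x) fun _ => by simp [tensorFil_one]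

theorem curvature_sub_mem_tensorFil {m k : ℕ} (h : k ≤ m) (x : A ⊗[K] Cochain K V) :
    S.curvature m x - S.curvature k x ∈ S.tensorFil V k := by
  rw [curvature, curvature, ← Finset.sum_Ico_eq_sub _ h]
  exact sum_mem fun l hl =>
    S.tensorFil_antitone (Finset.mem_Ico.1 hl).1 (S.tensorQ_const_mem_tensorFil l x)

theorem isMaurerCartan_iff {x : A ⊗[K] Cochain K V} :
    IsMaurerCartan (S.tensorDeg V) (S.tensorFil V) (S.tensorQ V) x ↔
      x ∈ S.tensorDeg V 0 ∧ ∀ k (I : Face V), coeff K A I (S.curvature k x) ∈ S.fil k := by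
  simp only [← mem_tensorFil_iff]
  refine and_congr_right fun _ => forall_congr' fun k => ⟨fun ⟨N, hN⟩ => ?_, fun h => ⟨k, ?_⟩⟩
  · have := sub_mem (hN (max k N) (le_max_right _ _))
      (S.curvature_sub_mem_tensorFil (le_max_left k N) x)
    simpa [curvature] using this
  · intro m hm
    simpa [curvature] using add_mem h (S.curvature_sub_mem_tensorFil hm x)

theorem coeff_tensorOp_one (I : Face V) (x : A ⊗[K] Cochain K V) :
    coeff K A I (S.tensorOp V 1 fun _ => x) = S.Q 1 fun _ => coeff K A I x := by
  rw [tensorOp_apply, map_sum, Fintype.sum_equiv (Equiv.funUnique (Fin 1) (Face V)) _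
    (fun J => if I = J then S.Q 1 (fun _ => coeff K A J x) else 0)]
  · simp
  · intro J
    have h : ∀ j : Fin 1, Finset.Iio j = ∅ := by decide
    simp only [h, Finset.sum_empty, koszul_zero, List.ofFn_succ, List.ofFn_zero, List.prod_cons,
      List.prod_nil, mul_one, coeff_tmul_basisCochain, Equiv.funUnique_apply]
    congr 2
    funext j
    rw [Subsingleton.elim j default]

/-- The Bianchi identity `∑ NQ(x, …, x, C, x, …, x) = 0` for the curvature `C` of `x`, up to terms of
high filtration. -/
theorem sum_tensorQ_curvature_mem_tensorFil (m : ℕ) {x : A ⊗[K] Cochain K V}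
    (hx : x ∈ S.tensorDeg V 0) :
    ∑ p ∈ Finset.range m ×ˢ Finset.range m,
      seqOp (S.tensorQ V) (p.1 + 1 + p.2) (Function.update (fun _ => x) p.1 (S.curvature m x)) ∈
      S.tensorFil V m := by
  let t : ℕ → ℕ → ℕ → A ⊗[K] Cochain K V := fun a b c =>
    seqOp (S.tensorQ V) (a + 1 + c) (insertSeq (S.tensorQ V) a b fun _ => x)
  have hins : ∀ a b, insertSeq (S.tensorQ V) a b (fun _ => x) =
      Function.update (fun _ => x) a (S.tensorQ V b fun _ => x) := by
    intro a b
    funext j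
    by_cases hj : j = a
    · subst hj; simp [insertSeq, seqOp]
    · simp [insertSeq, hj]
  -- Slot `a` carries the inner value, of weight `b`; each of the `a + c` other slots has weight
  -- one.
  have ht : ∀ a b c, t a b c ∈ S.tensorFil V (a + b + c) := by
    intro a b c
    have h := S.tensorQ_mem_tensorFil (a + 1 + c)
      (fun j => if (j : ℕ) = a then b else 1) (fun j => insertSeq (S.tensorQ V) a b (fun _ => x) j)
      fun j => by
        rw [hins]
        by_cases hj : (j : ℕ) = a
        · simpa [hj] using S.tensorQ_const_mem_tensorFil b x
        · simp [hj, tensorFil_one]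
    rwa [Fin.sum_univ_eq_sum_range (fun j => if j = a then b else 1), Finset.sum_range_add,
      Finset.sum_range_succ, Finset.sum_congr rfl fun i hi => if_neg (Finset.mem_range.1 hi).ne,
      Finset.sum_congr (s₁ := Finset.range c) rfl fun i hi => if_neg (by omega), if_pos rfl,
      Finset.sum_const, Finset.sum_const, Finset.card_range, Finset.card_range, smul_eq_mul,
      smul_eq_mul, mul_one, mul_one] at h
  have hsum : ∀ p : ℕ × ℕ, seqOp (S.tensorQ V) (p.1 + 1 + p.2)
      (Function.update (fun _ => x) p.1 (S.curvature m x)) =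
      ∑ b ∈ Finset.range m, t p.1 b p.2 := by
    intro p
    simp only [t, hins, curvature, seqOp]
    have hp : p.1 < p.1 + 1 + p.2 := by omega
    simp only [update_val_eq hp]
    rw [MultilinearMap.map_update_sum]
  -- The terms with `a + b + c ≥ m` are small by `ht`. Those with `a + b + c < m`, grouped by `n = a
  -- + b + c`, form complete A_∞-relations.
  rw [Finset.sum_congr rfl fun p _ => hsum p, ← Finset.sum_product',
    ← Finset.sum_filter_add_sum_filter_not _ fun p => p.1.1 + p.2 + p.1.2 < m]
  refine add_mem ?_ (sum_mem fun p hp => S.tensorFil_antitone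
    (not_lt.1 (Finset.mem_filter.1 hp).2) (ht _ _ _))
  suffices h : ∑ p ∈ (Finset.range m ×ˢ Finset.range m) ×ˢ Finset.range m with
      p.1.1 + p.2 + p.1.2 < m, t p.1.1 p.2 p.1.2 = 0 by
    rw [h]; exact zero_mem _
  rw [← Finset.sum_fiberwise_of_maps_to (t := Finset.range m) (g := fun p : (ℕ × ℕ) × ℕ => p.1.1 + p.2 + p.1.2)
    fun p hp => Finset.mem_range.2 (Finset.mem_filter.1 hp).2]
  refine Finset.sum_eq_zero fun n hn => ?_
  rw [← S.sum_insertSeq_tensorQ n (fun _ => x) fun _ => hx]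
  rw [Finset.mem_range] at hn
  refine Finset.sum_nbij' (fun p => ![p.1.1, p.2, p.1.2]) (fun abc => ((abc 0, abc 2), abc 1))
    ?_ ?_ ?_ ?_ ?_
  · intro p hp
    rw [Finset.Nat.mem_antidiagonalTuple, Fin.sum_univ_three]
    exact (Finset.mem_filter.1 hp).2
  · intro abc h
    rw [Finset.Nat.mem_antidiagonalTuple, Fin.sum_univ_three] at h
    simp only [Finset.mem_filter, Finset.mem_product, Finset.mem_range]
    omega
  · intro p _
    rfl
  · intro abc _
    funext j
    fin_cases j <;> rfl
  · intro p _
    rfl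

section Facet

variable {J : Face V} {v : V}

/-- If the Maurer-Cartan equation holds on all faces except possibly one facet of some face, it
holds on that facet too. -/
theorem coeff_curvature_facet_mem_fil (hv : v ∈ J.1) (hne : (J.1.erase v).Nonempty)
    {x : A ⊗[K] Cochain K V} (hx : x ∈ S.tensorDeg V 0)
    (h : ∀ k (I : Face V), I ≠ ⟨J.1.erase v, hne⟩ → coeff K A I (S.curvature k x) ∈ S.fil k)
    (k : ℕ) : coeff K A ⟨J.1.erase v, hne⟩ (S.curvature k x) ∈ S.fil k := by
  induction k with
  | zero => simp [S.fil_zero]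
  | succ k ih =>
    set C := S.curvature (k + 1) x with hC
    -- By induction all of `C` lies in `F^k`. The aim is to gain one step on the remaining facet.
    have hCk : C ∈ S.tensorFil V k := by
      rw [mem_tensorFil_iff]
      intro I
      by_cases hI : I = ⟨J.1.erase v, hne⟩
      · subst hI
        have := add_mem (S.coeff_mem_fil (S.curvature_sub_mem_tensorFil k.le_succ x)
          ⟨J.1.erase v, hne⟩) ih
        rwa [map_sub, sub_add_cancel] at this
      · exact S.fil_antitone k.le_succ (h (k + 1) I hI)
    have hB := S.sum_tensorQ_curvature_mem_tensorFil (k + 1) hx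
    have h0 : ((0, 0) : ℕ × ℕ) ∈ Finset.range (k + 1) ×ˢ Finset.range (k + 1) := by simp
    rw [← Finset.sum_erase_add _ _ h0] at hB
    -- Every Bianchi term other than `NQ_1(C)` has a further argument `x`, of weight one, so it lies
    -- in `F^{k+1}`.
    have hrest : ∑ p ∈ (Finset.range (k + 1) ×ˢ Finset.range (k + 1)).erase (0, 0),
        seqOp (S.tensorQ V) (p.1 + 1 + p.2) (Function.update (fun _ => x) p.1 C) ∈
        S.tensorFil V (k + 1) := by
      refine sum_mem fun p hp => ?_
      have hp' : 1 ≤ p.1 + p.2 := by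
        by_contra hc
        exact Finset.ne_of_mem_erase hp (Prod.ext (by simp; omega) (by simp; omega))
      have hQ := S.tensorQ_mem_tensorFil (p.1 + 1 + p.2)
        (fun j => if (j : ℕ) = p.1 then k else 1)
        (fun j => Function.update (fun _ => x) p.1 C (j : ℕ)) fun j => by
          by_cases hj : (j : ℕ) = p.1
          · simpa [hj] using hCk
          · simp [hj, tensorFil_one]
      rw [Fin.sum_univ_eq_sum_range (fun j => if j = p.1 then k else 1), Finset.sum_range_add,
        Finset.sum_range_succ, Finset.sum_congr rfl fun i hi => if_neg (Finset.mem_range.1 hi).ne,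
        Finset.sum_congr (s₁ := Finset.range p.2) rfl fun i hi => if_neg (by omega), if_pos rfl,
        Finset.sum_const, Finset.sum_const, Finset.card_range, Finset.card_range, smul_eq_mul,
        smul_eq_mul, mul_one, mul_one] at hQ
      exact S.tensorFil_antitone (by omega) hQ
    have hQ1 : S.tensorOp V 1 (fun _ => C) + S.tensorD V C ∈ S.tensorFil V (k + 1) := by
      have := sub_mem hB hrest
      rw [add_sub_cancel_left] at this
      have he : (fun j : Fin 1 => Function.update (fun _ => x) 0 C (j : ℕ)) = fun _ => C := by
        funext j
        rw [Subsingleton.elim j 0]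
        rfl
      change S.tensorQ V 1 (fun j : Fin 1 => Function.update (fun _ => x) 0 C (j : ℕ)) ∈ _ at this
      rwa [he] at this
    have h1 : coeff K A J (S.tensorOp V 1 fun _ => C) ∈ S.fil (k + 1) := by
      rw [coeff_tensorOp_one]
      simpa using S.Q_fil 1 (fun _ => k + 1) _ fun _ => h (k + 1) J (facet_ne hv hne)
    -- On `J`, `NQ_1(C)` consists of `Q_1(C_J)`, small by hypothesis, and the coboundary, whose only
    -- uncontrolled term is the facet coefficient up to sign.
    have h2 := S.coeff_tensorD_sub_mem_fil hv hne (k := k + 1) (x := C) fun I hI => h _ I hI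
    have h3 := S.coeff_mem_fil hQ1 J
    rw [map_add] at h3
    have h4 := sub_mem (sub_mem h3 h1) h2
    rw [add_sub_cancel_left, sub_sub_cancel] at h4
    exact S.mem_fil_of_sign_smul_koszul h4

/-- Each surviving term of the expansion has a slot filled by `y`, of weight `k`, and `l - 1` other
slots of weight at least one. For `l = 0` there are no such terms. -/
theorem tensorQ_add_sub_mem_tensorFil {k l : ℕ} (hl : l ≠ 1)
    (x : A ⊗[K] Cochain K V) {y : A ⊗[K] Cochain K V} (hy : y ∈ S.tensorFil V k) :
    (S.tensorQ V l fun _ => x + y) - (S.tensorQ V l fun _ => x) ∈ S.tensorFil V (k + 1) := by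
  have h := (S.tensorQ V l).map_add_univ (fun _ => x) (fun _ => y)
  change (S.tensorQ V l fun _ => x + y) = _ at h
  rw [h, ← Finset.sum_erase_add _ _ (Finset.mem_univ Finset.univ), Finset.piecewise_univ,
    add_sub_cancel_right]
  refine sum_mem fun s hs => ?_
  obtain ⟨i, hi⟩ : ∃ i, i ∉ s := by
    by_contra! hc
    exact Finset.ne_of_mem_erase hs (Finset.eq_univ_iff_forall.2 hc)
  have hQ := S.tensorQ_mem_tensorFil l (fun j => if j = i then k else 1)
    (s.piecewise (fun _ => x) fun _ => y) fun j => by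
      by_cases hj : j = i
      · subst hj; simpa [hi] using hy
      · simp [hj, tensorFil_one]
  rw [← Finset.sum_erase_add _ _ (Finset.mem_univ i), if_pos rfl,
    Finset.sum_congr rfl fun j hj => if_neg (Finset.ne_of_mem_erase hj), Finset.sum_const,
    Finset.card_erase_of_mem (Finset.mem_univ i), Finset.card_univ, Fintype.card_fin,
    smul_eq_mul, mul_one] at hQ
  have := i.pos
  exact S.tensorFil_antitone (by omega) hQ

/-- The dependence of the curvature on a face `J` on the value at a facet of `J`. -/
theorem coeff_curvature_add_sub_mem_fil (hv : v ∈ J.1) (hne : (J.1.erase v).Nonempty)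
    {k m : ℕ} (hm : 2 ≤ m) (x : A ⊗[K] Cochain K V) {a : A} (ha : a ∈ S.fil k) :
    coeff K A J (S.curvature m (x + a ⊗ₜ[K] Cochain.basisCochain ⟨J.1.erase v, hne⟩)) -
      coeff K A J (S.curvature m x) - (-1 : K) ^ (J.1.filter (· < v)).card • S.koszul 1 a ∈
      S.fil (k + 1) := by
  set y : A ⊗[K] Cochain K V := a ⊗ₜ[K] Cochain.basisCochain ⟨J.1.erase v, hne⟩ with hy
  have hcoeff : ∀ I : Face V, I ≠ ⟨J.1.erase v, hne⟩ → coeff K A I y = 0 := by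
    intro I hI
    rw [hy, coeff_tmul_basisCochain, if_neg hI]
  have h1 : (S.tensorQ V 1 fun _ => x + y) - (S.tensorQ V 1 fun _ => x) =
      S.tensorQ V 1 fun _ => y := by
    have h := (S.tensorQ V 1).map_update_add (fun _ => x) 0 x y
    simp only [Function.update_eq_self] at h
    have e : ∀ z : A ⊗[K] Cochain K V, Function.update (fun _ : Fin 1 => x) 0 z = fun _ => z := by
      intro z; funext j; rw [Subsingleton.elim j 0]; simp
    rw [e, e] at h
    rw [h, add_sub_cancel_left]
  have h2 := S.coeff_tensorD_sub_mem_fil hv hne (k := k + 1) (x := y) fun I hI => by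
    rw [hcoeff I hI]; exact zero_mem _
  rw [hy, coeff_tmul_basisCochain, if_pos rfl, ← hy] at h2
  -- The `Q_1` part preserves the supporting face, and `y` lives on a facet of `J`, so only the
  -- coboundary reaches `J`.
  have h3 : coeff K A J (S.tensorQ V 1 fun _ => y) = coeff K A J (S.tensorD V y) := by
    rw [tensorQ_one_apply, map_add, coeff_tensorOp_one, hcoeff J (facet_ne hv hne)]
    rw [(S.Q 1).map_coord_zero 0 rfl, zero_add]
  -- The condition `2 ≤ m` ensures that the linear term `l = 1` is in the partial sum.
  rw [← map_sub, curvature, curvature, ← Finset.sum_sub_distrib,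
    ← Finset.sum_erase_add _ _ (Finset.mem_range.2 hm), h1, map_add, h3, add_sub_assoc]
  refine add_mem (S.coeff_mem_fil (sum_mem fun l hl => ?_) J) h2
  exact S.tensorQ_add_sub_mem_tensorFil (Finset.ne_of_mem_erase hl) x
    (S.tmul_mem_tensorFil _ ha)

theorem coeff_curvature_mem_fil_of_le {k m : ℕ} (h : k ≤ m) {x : A ⊗[K] Cochain K V}
    (hx : coeff K A J (S.curvature m x) ∈ S.fil k) :
    coeff K A J (S.curvature k x) ∈ S.fil k := by
  have := sub_mem hx (S.coeff_mem_fil (S.curvature_sub_mem_tensorFil h x) J)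
  rwa [map_sub, sub_sub_cancel] at this

/-- The Maurer-Cartan equation on a face has a solution in the value at a given facet. -/
theorem exists_facet_value (hv : v ∈ J.1) (hne : (J.1.erase v).Nonempty)
    {x : A ⊗[K] Cochain K V} (hx : x ∈ S.tensorDeg V 0) :
    ∃ a ∈ S.deg (-Face.dim ⟨J.1.erase v, hne⟩), ∀ k, coeff K A J
      (S.curvature k (x + a ⊗ₜ[K] Cochain.basisCochain ⟨J.1.erase v, hne⟩)) ∈ S.fil k := by
  set F : Face V := ⟨J.1.erase v, hne⟩ with hF
  set ε : K := (-1) ^ (J.1.filter (· < v)).card with hε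
  have hεε : ε * ε = 1 := by rw [hε, ← mul_pow, neg_one_mul, neg_neg, one_pow]
  let X : A → A ⊗[K] Cochain K V := fun a => x + a ⊗ₜ[K] Cochain.basisCochain F
  have hX : ∀ a b, X (a + b) = X a + b ⊗ₜ[K] Cochain.basisCochain F := by
    intro a b
    simp only [X, TensorProduct.add_tmul, add_assoc]
  -- Each step subtracts the current error on `J`, corrected by the sign with which the facet
  -- coefficient enters the coboundary.
  let s : ℕ → A := fun n => Nat.rec 0
    (fun k a => a + -(ε • S.koszul 1 (coeff K A J (S.curvature (k + 1) (X a))))) n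
  have hs : ∀ k, s (k + 1) = s k + -(ε • S.koszul 1 (coeff K A J (S.curvature (k + 1) (X (s k))))) :=
    fun _ => rfl
  -- The curvature has degree one, so its coefficient on `J` has degree `1 - J.dim = -F.dim`, the
  -- degree required of the correction.
  have hdim : J.dim = F.dim + 1 := by
    have := Finset.card_erase_add_one hv
    simp only [Face.dim, hF]
    omega
  have hXdeg : ∀ a ∈ S.deg (-F.dim), X a ∈ S.tensorDeg V 0 := fun a ha =>
    add_mem hx (S.tmul_mem_tensorDeg ha (basisCochain_mem F) (neg_add_cancel _))
  have hsdeg : ∀ k, s k ∈ S.deg (-F.dim) := by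
    intro k
    induction k with
    | zero => exact zero_mem _
    | succ k ih =>
      rw [hs]
      refine add_mem ih (neg_mem (Submodule.smul_mem _ _ (S.koszul_mem_deg 1 ?_)))
      have := S.coeff_mem_deg (S.curvature_mem_tensorDeg (k + 1) (hXdeg _ ih)) J
      rwa [hdim, show (1 : ℤ) - (F.dim + 1) = -F.dim by ring] at this
  have hinv : ∀ k, coeff K A J (S.curvature k (X (s k))) ∈ S.fil k ∧ s (k + 1) - s k ∈ S.fil k := by
    have hstep : ∀ k, coeff K A J (S.curvature k (X (s k))) ∈ S.fil k →
        coeff K A J (S.curvature (k + 1) (X (s k))) ∈ S.fil k := by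
      intro k h
      have := add_mem (S.coeff_mem_fil (S.curvature_sub_mem_tensorFil k.le_succ (X (s k))) J) h
      rwa [map_sub, sub_add_cancel] at this
    have hinc : ∀ k, coeff K A J (S.curvature k (X (s k))) ∈ S.fil k →
        -(ε • S.koszul 1 (coeff K A J (S.curvature (k + 1) (X (s k))))) ∈ S.fil k := fun k h =>
      neg_mem (Submodule.smul_mem _ _ (S.koszul_mem_fil 1 (hstep k h)))
    have h1 : ∀ k, coeff K A J (S.curvature k (X (s k))) ∈ S.fil k := by
      intro k
      induction k with
      | zero => simp [S.fil_zero]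
      | succ k ih =>
        rcases Nat.eq_zero_or_pos k with rfl | hk
        · simp [S.fil_one]
        · have h := S.coeff_curvature_add_sub_mem_fil hv hne (m := k + 1) (by omega) (X (s k))
            (hinc k ih)
          -- As `ε` and `koszul 1` square to the identity, the leading effect of the correction
          -- cancels the old error exactly, leaving an error in `F^{k+1}`.
          rw [← hF, ← hX, ← hs, ← hε, map_neg, map_smul, koszul_one_koszul_one, smul_neg, smul_smul,
            hεε, one_smul, sub_neg_eq_add, sub_add_cancel] at h
          exact h
    exact fun k => ⟨h1 k, by rw [hs, add_sub_cancel_left]; exact hinc k (h1 k)⟩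
  have hcauchy : ∀ k m, k ≤ m → s m - s k ∈ S.fil k := by
    intro k m hkm
    induction m, hkm using Nat.le_induction with
    | base => rw [sub_self]; exact zero_mem _
    | succ m hkm ih =>
      rw [← sub_add_sub_cancel _ (s m)]
      exact add_mem (S.fil_antitone hkm (hinv m).2) ih
  obtain ⟨a, ha, hlim⟩ := S.fil_complete (-F.dim) s hsdeg fun k => ⟨k, fun m hm m' hm' => by
    rw [← sub_sub_sub_cancel_right _ _ (s k)]
    exact sub_mem (hcauchy k m hm) (hcauchy k m' hm')⟩
  refine ⟨a, ha, fun k => ?_⟩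
  rcases lt_or_ge k 2 with hk | hk
  · have : S.fil k = ⊤ := by
      interval_cases k
      exacts [S.fil_zero, S.fil_one]
    rw [this]
    exact Submodule.mem_top
  obtain ⟨N, hN⟩ := hlim k
  have hd : a - s (max k N) ∈ S.fil k := by
    rw [← neg_sub]
    exact neg_mem (hN _ (le_max_right _ _))
  -- Replacing the approximation by the limit changes the argument by an element of `F^k`, hence
  -- also the curvature on `J`.
  have h := S.fil_antitone k.le_succ
    (S.coeff_curvature_add_sub_mem_fil hv hne hk (X (s (max k N))) hd)
  rw [← hF, ← hX, add_sub_cancel] at h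
  have h' := S.coeff_curvature_mem_fil_of_le (le_max_left k N)
    (S.fil_antitone (le_max_left k N) (hinv (max k N)).1)
  have := add_mem (add_mem h (Submodule.smul_mem _ ε (S.koszul_mem_fil 1 hd))) h'
  rwa [sub_add_cancel, sub_add_cancel] at this

/-- The Maurer-Cartan equation on a face determines the value at a given facet. -/
theorem facet_value_unique (hv : v ∈ J.1) (hne : (J.1.erase v).Nonempty)
    {x : A ⊗[K] Cochain K V} {a : A} (hx : ∀ k, coeff K A J (S.curvature k x) ∈ S.fil k)
    (hxa : ∀ k, coeff K A J
      (S.curvature k (x + a ⊗ₜ[K] Cochain.basisCochain ⟨J.1.erase v, hne⟩)) ∈ S.fil k) :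
    a = 0 := by
  refine S.eq_zero_of_forall_mem_fil fun k => ?_
  induction k with
  | zero => simp [S.fil_zero]
  | succ k ih =>
    rcases Nat.eq_zero_or_pos k with rfl | hk
    · simp [S.fil_one]
    -- Both curvatures on `J` are in `F^{k+1}`, so the leading term of their difference, `a` up to
    -- sign, is too. Separatedness then gives `a = 0`.
    · have h := S.coeff_curvature_add_sub_mem_fil hv hne (m := k + 1) (by omega) x ih
      have h' := sub_mem (sub_mem (hxa (k + 1)) (hx (k + 1))) h
      rw [sub_sub_cancel] at h'
      exact S.mem_fil_of_sign_smul_koszul h'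

end Facet

end CompleteShiftedAInfinity

/-- The image of a face under an order preserving map of vertices. -/
def Face.image {V W : Type} [LinearOrder V] [LinearOrder W] (θ : V →o W) (I : Face V) : Face W :=
  ⟨I.1.image θ, I.2.image θ⟩

/-! ### Faces of a simplex and relative horn filling. -/

namespace CompleteShiftedAInfinity

variable {K : Type u} [Field K] {A B : Type v} [AddCommGroup A] [Module K A]
  [AddCommGroup B] [Module K B]

theorem coeff_tensorPullback {V W : Type} [LinearOrder V] [LinearOrder W] {θ : V →o W}
    {I : Face V} (hθ : Set.InjOn θ I.1) (x : A ⊗[K] Cochain K W) :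
    coeff K A I (tensorPullback θ x) = coeff K A (I.image θ) x := by
  classical
  induction x with
  | zero => simp
  | add x y hx hy => simp only [map_add, hx, hy]
  | tmul a φ =>
    rw [tensorPullback_tmul, coeff_tmul, coeff_tmul, Cochain.pullback_apply, if_pos hθ]
    congr 1
    exact Cochain.evalOn_face φ (I.image θ)

theorem tensorPullback_curvature (S : CompleteShiftedAInfinity K A) {V W : Type} [LinearOrder V]
    [LinearOrder W] [Fintype V] [Fintype W] (θ : V →o W) (m : ℕ) (x : A ⊗[K] Cochain K W) :
    S.curvature m (tensorPullback θ x) = tensorPullback θ (S.curvature m x) := by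
  simp only [curvature, map_sum]
  exact Finset.sum_congr rfl fun l _ => S.tensorPullback_tensorQ θ l fun _ => x

/-- A degree zero map commutes with the projections to homogeneous components, so the degree `p`
component of any preimage is again a preimage. -/
theorem StrictHom.exists_mem_deg_of_surjective {S : CompleteShiftedAInfinity K A}
    {T : CompleteShiftedAInfinity K B} (f : StrictHom S T) (hf : Function.Surjective f.toLinearMap)
    {p : ℤ} {b : B} (hb : b ∈ T.deg p) : ∃ a ∈ S.deg p, f.toLinearMap a = b := by
  have h : ∀ a, f.toLinearMap (DirectSum.decompose S.deg a p) =
      DirectSum.decompose T.deg (f.toLinearMap a) p := by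
    intro a
    induction a using DirectSum.Decomposition.inductionOn S.deg with
    | zero => simp
    | @homogeneous q a =>
      by_cases hq : q = p
      · subst hq
        rw [DirectSum.decompose_of_mem_same _ a.2,
          DirectSum.decompose_of_mem_same _ (f.map_deg q _ a.2)]
      · rw [DirectSum.decompose_of_mem_ne _ a.2 hq,
          DirectSum.decompose_of_mem_ne _ (f.map_deg q _ a.2) hq, map_zero]
    | add x y hx hy => simp [DirectSum.decompose_add, hx, hy]
  obtain ⟨a, rfl⟩ := hf b
  exact ⟨DirectSum.decompose S.deg a p, (DirectSum.decompose S.deg a p).2,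
    (h a).trans (DirectSum.decompose_of_mem_same _ hb)⟩

/-- The inclusion of vertices of the `j`-th codimension one face of a simplex. -/
abbrev faceMap {n : ℕ} (j : Fin (n + 2)) : Fin (n + 1) →o Fin (n + 2) :=
  (Fin.succAboveOrderEmb j).toOrderHom

theorem faceMap_injOn {n : ℕ} (j : Fin (n + 2)) (I : Face (Fin (n + 1))) :
    Set.InjOn (faceMap j) I.1 :=
  (Fin.succAboveOrderEmb j).injective.injOn

theorem notMem_image_faceMap {n : ℕ} (j : Fin (n + 2)) (I : Face (Fin (n + 1))) :
    j ∉ (I.image (faceMap j)).1 := by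
  intro h
  obtain ⟨z, _, hz⟩ := Finset.mem_image.1 h
  exact Fin.succAbove_ne j z hz

/-- Such a face misses some vertex `j ≠ i`. Thus the horn contains all faces but two. -/
theorem exists_eq_image_faceMap {n : ℕ} {i : Fin (n + 2)} {I : Face (Fin (n + 2))}
    (h1 : I.1 ≠ Finset.univ) (h2 : I.1 ≠ Finset.univ.erase i) :
    ∃ (j : Fin (n + 2)) (_ : j ≠ i) (I' : Face (Fin (n + 1))), I'.image (faceMap j) = I := by
  obtain ⟨j, hji, hj⟩ : ∃ j, j ≠ i ∧ j ∉ I.1 := by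
    by_contra! hc
    by_cases hi : i ∈ I.1
    · exact h1 (Finset.eq_univ_iff_forall.2 fun j => by
        by_cases hj : j = i
        · rwa [hj]
        · exact hc j hj)
    · refine h2 (Finset.ext fun j => ?_)
      by_cases hj : j = i
      · simp [hj, hi]
      · simp [hj, hc j hj]
  have himg : (Finset.univ.filter fun z => j.succAbove z ∈ I.1).image (faceMap j) = I.1 := by
    ext w
    simp only [Finset.mem_image, Finset.mem_filter, Finset.mem_univ, true_and]
    constructor
    · rintro ⟨z, hz, rfl⟩
      exact hz
    · intro hw
      obtain ⟨z, rfl⟩ := Fin.exists_succAbove_eq (x := w) (y := j) fun h => hj (h ▸ hw)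
      exact ⟨z, hw, rfl⟩
  have hne : (Finset.univ.filter fun z => j.succAbove z ∈ I.1).Nonempty := by
    rw [← Finset.image_nonempty (f := faceMap j), himg]
    exact I.2
  exact ⟨j, hji, ⟨_, hne⟩, Subtype.ext himg⟩

/-- Relative horn filling for Maurer-Cartan elements. -/
theorem StrictHom.exists_horn_filler {S : CompleteShiftedAInfinity K A}
    {T : CompleteShiftedAInfinity K B} (f : StrictHom S T) (hf : Function.Surjective f.toLinearMap)
    {n : ℕ} (i : Fin (n + 2)) (h : ∀ j, j ≠ i → A ⊗[K] Cochain K (Fin (n + 1)))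
    (hMC : ∀ j hj, IsMaurerCartan (S.tensorDeg _) (S.tensorFil _) (S.tensorQ _) (h j hj))
    (hcompat : ∀ j hj I j' hj' I', I.image (faceMap j) = I'.image (faceMap j') →
      coeff K A I (h j hj) = coeff K A I' (h j' hj'))
    {y : B ⊗[K] Cochain K (Fin (n + 2))}
    (hy : IsMaurerCartan (T.tensorDeg _) (T.tensorFil _) (T.tensorQ _) y)
    (hfy : ∀ j hj, f.tensor _ (h j hj) = tensorPullback (faceMap j) y) :
    ∃ x, IsMaurerCartan (S.tensorDeg _) (S.tensorFil _) (S.tensorQ _) x ∧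
      (∀ j hj, tensorPullback (faceMap j) x = h j hj) ∧ f.tensor _ x = y := by
  classical
  let top : Face (Fin (n + 2)) := ⟨Finset.univ, Finset.univ_nonempty⟩
  have hi : i ∈ top.1 := Finset.mem_univ i
  have hne : (top.1.erase i).Nonempty := by
    obtain ⟨j, hj⟩ := exists_ne i
    exact ⟨j, Finset.mem_erase.2 ⟨hj, Finset.mem_univ j⟩⟩
  set opp : Face (Fin (n + 2)) := ⟨top.1.erase i, hne⟩ with hopp
  have hexists : ∀ I, I ≠ top → I ≠ opp → ∃ (j : Fin (n + 2)) (_ : j ≠ i)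
      (I' : Face (Fin (n + 1))), I'.image (faceMap j) = I := fun I h1 h2 =>
    exists_eq_image_faceMap (fun h => h1 (Subtype.ext h)) fun h => h2 (Subtype.ext h)
  have htop : ∀ j (I : Face (Fin (n + 1))), I.image (faceMap j) ≠ top := fun j I h =>
    notMem_image_faceMap j I (by rw [h]; exact Finset.mem_univ j)
  have hopp' : ∀ j, j ≠ i → ∀ I : Face (Fin (n + 1)), I.image (faceMap j) ≠ opp := fun j hj I h =>
    notMem_image_faceMap j I (by rw [h]; exact Finset.mem_erase.2 ⟨hj, Finset.mem_univ j⟩)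
  obtain ⟨c, hc, hfc⟩ := f.exists_mem_deg_of_surjective hf (T.coeff_mem_deg hy.1 top)
  -- The choice of a horn face containing `I` is immaterial by `hcompat`. The default `0` is reached
  -- only at `opp`, which is left out of `x₀`.
  let X : Face (Fin (n + 2)) → A := fun I =>
    if I = top then c else
      if hI : ∃ (j : Fin (n + 2)) (_ : j ≠ i) (I' : Face (Fin (n + 1))),
        I'.image (faceMap j) = I then
        coeff K A hI.choose_spec.choose_spec.choose (h hI.choose hI.choose_spec.choose) else 0
  have hXtop : X top = c := if_pos rfl
  have hXimage : ∀ j hj I, X (I.image (faceMap j)) = coeff K A I (h j hj) := by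
    intro j hj I
    have hI : ∃ (j' : Fin (n + 2)) (_ : j' ≠ i) (I' : Face (Fin (n + 1))),
      I'.image (faceMap j') = I.image (faceMap j) := ⟨j, hj, I, rfl⟩
    simp only [X, if_neg (htop j I), dif_pos hI]
    exact hcompat _ _ _ _ _ _ hI.choose_spec.choose_spec.choose_spec
  have hXdeg : ∀ I, I ≠ opp → X I ∈ S.deg (0 - I.dim) := by
    intro I hI
    by_cases hI' : I = top
    · rw [hI', hXtop]; exact hc
    · obtain ⟨j, hj, I', rfl⟩ := hexists I hI' hI
      rw [hXimage j hj]
      have : (I'.image (faceMap j)).dim = I'.dim := by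
        simp only [Face.dim, Face.image, Finset.card_image_of_injOn (faceMap_injOn j I')]
      rw [this]
      exact S.coeff_mem_deg (hMC j hj).1 I'
  let x₀ : A ⊗[K] Cochain K (Fin (n + 2)) := ∑ I ∈ Finset.univ.erase opp,
    X I ⊗ₜ[K] (Cochain.basisCochain I : Cochain K (Fin (n + 2)))
  have hx₀ : x₀ ∈ S.tensorDeg _ 0 := sum_mem fun I hI =>
    S.tmul_mem_tensorDeg (hXdeg I (Finset.ne_of_mem_erase hI)) (basisCochain_mem I)
      (sub_add_cancel _ _)
  obtain ⟨a, ha, hxa⟩ := S.exists_facet_value hi hne hx₀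
  rw [← hopp] at ha hxa
  set x := x₀ + a ⊗ₜ[K] Cochain.basisCochain opp with hx
  have hcoeff : ∀ I, I ≠ opp → coeff K A I x = X I := by
    intro I hI
    rw [hx, map_add, coeff_tmul_basisCochain, if_neg hI, add_zero, map_sum]
    simp only [coeff_tmul_basisCochain]
    rw [Finset.sum_ite_eq, if_pos (Finset.mem_erase.2 ⟨hI, Finset.mem_univ I⟩)]
  have hface : ∀ j hj, tensorPullback (faceMap j) x = h j hj := by
    intro j hj
    refine ext_coeff fun I => ?_
    rw [coeff_tensorPullback (faceMap_injOn j I), hcoeff _ (hopp' j hj I), hXimage j hj]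
  have hxdeg : x ∈ S.tensorDeg _ 0 :=
    add_mem hx₀ (S.tmul_mem_tensorDeg ha (basisCochain_mem opp) (neg_add_cancel _))
  -- On the top face the equation holds by the choice of `a`; on the faces of the horn it is
  -- inherited, since curvature commutes with pullback.
  have hcurv : ∀ k (I : Face (Fin (n + 2))), I ≠ opp →
      coeff K A I (S.curvature k x) ∈ S.fil k := by
    intro k I hI
    by_cases hI' : I = top
    · rw [hI']; exact hxa k
    · obtain ⟨j, hj, I', rfl⟩ := hexists I hI' hI
      rw [← coeff_tensorPullback (faceMap_injOn j I'), ← tensorPullback_curvature, hface j hj]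
      exact (S.isMaurerCartan_iff.1 (hMC j hj)).2 k I'
  have hxMC : IsMaurerCartan (S.tensorDeg _) (S.tensorFil _) (S.tensorQ _) x := by
    refine S.isMaurerCartan_iff.2 ⟨hxdeg, fun k I => ?_⟩
    by_cases hI : I = opp
    · rw [hI]; exact S.coeff_curvature_facet_mem_fil hi hne hxdeg hcurv k
    · exact hcurv k I hI
  refine ⟨x, hxMC, hface, ?_⟩
  -- The only possible discrepancy between `f x` and `y` is on `opp`. Both solve the equation on the
  -- top face, so uniqueness kills it.
  set b : B := coeff K B opp y - f.toLinearMap (coeff K A opp x) with hb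
  have hyx : y = f.tensor _ x + b ⊗ₜ[K] Cochain.basisCochain opp := by
    refine ext_coeff fun I => ?_
    rw [map_add, coeff_tensor, coeff_tmul_basisCochain]
    by_cases hI : I = opp
    · rw [if_pos hI, hI, hb, add_sub_cancel]
    · rw [if_neg hI, add_zero, hcoeff I hI]
      by_cases hI' : I = top
      · rw [hI', hXtop, hfc]
      · obtain ⟨j, hj, I', rfl⟩ := hexists I hI' hI
        rw [hXimage j hj, ← coeff_tensor, hfy j hj, coeff_tensorPullback (faceMap_injOn j I')]
  have hb0 : b = 0 := by
    refine T.facet_value_unique hi hne (x := f.tensor _ x)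
      (fun k => (T.isMaurerCartan_iff.1 (f.tensor_isMaurerCartan hxMC)).2 k top) fun k => ?_
    rw [← hopp, ← hyx]
    exact (T.isMaurerCartan_iff.1 hy).2 k top
  rw [hyx, hb0, TensorProduct.zero_tmul, add_zero]

end CompleteShiftedAInfinity

/-! ### From simplicial horns to compatible families of Maurer-Cartan elements. -/

namespace CompleteShiftedAInfinity

open Simplicial

variable {K : Type u} [Field K] {A : Type v} [AddCommGroup A] [Module K A]

/-- Two faces of a horn of Maurer-Cartan elements have the same coefficients on a common subface. -/
theorem coeff_horn_face_eq {S : CompleteShiftedAInfinity K A} {n : ℕ} {i : Fin (n + 2)}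
    (t : (SSet.horn (n + 1) i : SSet.{max u v}) ⟶ S.mcSSet)
    (j : Fin (n + 2)) (hj : j ≠ i) (I : Face (Fin (n + 1)))
    (j' : Fin (n + 2)) (hj' : j' ≠ i) (I' : Face (Fin (n + 1)))
    (hII : I.image (faceMap j) = I'.image (faceMap j')) :
    coeff K A I (t.app _ (SSet.horn.face i j hj)).1 =
      coeff K A I' (t.app _ (SSet.horn.face i j' hj')).1 := by
  obtain ⟨m, hm⟩ : ∃ m, I.1.card = m + 1 := ⟨I.1.card - 1, by have := I.2.card_pos; omega⟩
  have hm' : I'.1.card = m + 1 := by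
    have h := congrArg (fun F : Face _ => F.1.card) hII
    simp only [Face.image, Finset.card_image_of_injOn (faceMap_injOn _ _)] at h
    omega
  let top : Face (Fin (m + 1)) := ⟨Finset.univ, Finset.univ_nonempty⟩
  let θ : Fin (m + 1) →o Fin (n + 1) := (I.1.orderEmbOfFin hm).toOrderHom
  let θ' : Fin (m + 1) →o Fin (n + 1) := (I'.1.orderEmbOfFin hm').toOrderHom
  have hθ : top.image θ = I := Subtype.ext (Finset.image_orderEmbOfFin_univ I.1 hm)
  have hθ' : top.image θ' = I' := Subtype.ext (Finset.image_orderEmbOfFin_univ I'.1 hm')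
  -- Both composites are the increasing enumeration of the same vertex set, which determines them.
  have hcomp : (faceMap j).comp θ = (faceMap j').comp θ' := by
    have key : ∀ (j : Fin (n + 2)) (I : Face (Fin (n + 1))) (hm : I.1.card = m + 1)
        (hc : (I.image (faceMap j)).1.card = m + 1) (z : Fin (m + 1)),
        faceMap j (I.1.orderEmbOfFin hm z) = (I.image (faceMap j)).1.orderEmbOfFin hc z := by
      intro j I hm hc z
      refine congrFun (Finset.orderEmbOfFin_unique hc (f := fun z => faceMap j _) (fun z => ?_)
        ?_) z
      · exact Finset.mem_image_of_mem _ (Finset.orderEmbOfFin_mem _ _ _)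
      · exact (Fin.succAboveOrderEmb j).strictMono.comp (OrderEmbedding.strictMono _)
    have hc : (I.image (faceMap j)).1.card = m + 1 := by
      rw [← hm]; exact Finset.card_image_of_injOn (faceMap_injOn j I)
    ext1
    funext z
    refine (key j I hm hc z).trans ?_
    simp only [hII]
    exact (key j' I' hm' (hII ▸ hc) z).symm
  -- The two restrictions are the same simplex of the horn, since simplices of the horn are
  -- simplices of the standard simplex. Naturality of `t` carries this equality over to the
  -- Maurer-Cartan elements.
  have hface : (SSet.horn (n + 1) i : SSet.{max u v}).map
      (SimplexCategory.mkHom θ).op (SSet.horn.face i j hj) = (SSet.horn (n + 1) i : SSet.{max u v}).map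
      (SimplexCategory.mkHom θ').op (SSet.horn.face i j' hj') := by
    apply Subtype.ext
    apply SSet.stdSimplex.objEquiv.injective
    apply SimplexCategory.Hom.ext
    exact hcomp
  have h := congrArg (fun s => coeff K A top (t.app _ s).1) hface
  have hnat : ∀ (θ : Fin (m + 1) →o Fin (n + 1)) s,
      (t.app _ ((SSet.horn (n + 1) i : SSet.{max u v}).map (SimplexCategory.mkHom θ).op s)).1 =
      tensorPullback θ (t.app _ s).1 := by
    intro θ s
    exact congrArg Subtype.val (ConcreteCategory.congr_hom
      (t.naturality (SimplexCategory.mkHom θ).op) s)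
  simp only [hnat] at h
  rwa [coeff_tensorPullback (I.1.orderEmbOfFin hm).injective.injOn,
    coeff_tensorPullback (I'.1.orderEmbOfFin hm').injective.injOn, hθ, hθ'] at h

end CompleteShiftedAInfinity

end AInfinity

end

theorem mainTheorem2 {K : Type u} [Field K] {A B : Type v} [AddCommGroup A] [Module K A]
    [AddCommGroup B] [Module K B] (Q : AInfinity.CompleteShiftedAInfinity K A)
    (P : AInfinity.CompleteShiftedAInfinity K B)
    (f : AInfinity.CompleteShiftedAInfinity.StrictHom Q P)
    (hf : Function.Surjective f.toLinearMap) :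
    HomotopicalAlgebra.Fibration f.mcMap := by
  rw [SSet.modelCategoryQuillen.fibration_iff]
  intro X Y g hg
  -- Fibrations are tested against the generating set `J` of horn inclusions Λ[n+1,i] ⊆ Δ[n+1].
  simp only [SSet.modelCategoryQuillen.J, MorphismProperty.iSup_iff] at hg
  obtain ⟨n, ⟨i⟩⟩ := hg
  refine ⟨fun {t b} sq => ?_⟩
  obtain ⟨x, hx, hface, hfx⟩ := f.exists_horn_filler hf i
    (fun j hj => (t.app _ (SSet.horn.face i j hj)).1)
    (fun j hj => (t.app _ (SSet.horn.face i j hj)).2)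
    (AInfinity.CompleteShiftedAInfinity.coeff_horn_face_eq t)
    (SSet.yonedaEquiv b).2 (fun j hj => by
      -- The square evaluated on the `j`-th face of the horn, combined with naturality of `b` at the
      -- coface `δ j`, says that the `j`-th horn face lies over the `j`-th face of `y`.
      have h := ConcreteCategory.congr_hom (congr_app sq.w _) (SSet.horn.face i j hj)
      have h' := ConcreteCategory.congr_hom (b.naturality (SimplexCategory.δ j).op)
        (SSet.yonedaEquiv (𝟙 _))
      exact congrArg Subtype.val (h.trans h'))
  refine ⟨⟨{ l := SSet.yonedaEquiv.symm ⟨x, hx⟩, fac_left := ?_, fac_right := ?_ }⟩⟩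
  · refine SSet.horn.hom_ext _ _ fun j hj => ?_
    exact Subtype.ext (hface j hj)
  · exact (SSet.yonedaEquiv_symm_comp _ _).trans
      ((Equiv.symm_apply_eq _).2 (Subtype.ext hfx))
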